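/- Let $\mathcal{O}=\mathbb{C}[\![x_1,\dots,x_n]\!]$ with maximal ideal $\mathfrak{m}$, let $\mathrm{Der}$ be the $\mathcal{O}$-module of $\mathbb{C}$-linear derivations of $\mathcal{O}$, and for $f\in\mathcal{O}$ let $\mathrm{Der}_f=\{\delta\in\mathrm{Der}\mid\delta(\mathcal{O}f)\subseteq\mathcal{O}f\}$. Every $\delta\in\mathfrak{m}\cdot\mathrm{Der}$ has a linear part $\delta_0=\sum_{i,j}a_{ij}x_i\partial_j$, where $a_{ij}\in\mathbb{C}$ is the coefficient of $x_i$ in $\delta(x_j)$; put $A=(a_{ij})$. Call $\delta$ diagonal (resp. semisimple) if $\delta=\delta_0$ and $A$ is diagonal (resp. semisimple), and nilpotent if $A$ is nilpotent. Write $\delta=\delta_S+\delta_N$ for the unique decomposition with $\delta_S$ semisimple, $\delta_N$ nilpotent and $[\delta_{S,0},\delta_{N,0}]=0$. Two series $f,g$ are formally contact equivalent if $g=u\cdot\varphi(f)$ for a unit $u\in\mathcal{O}^*$ and a formal coordinate change $\varphi$, i.e. a $\mathbb{C}$-algebra automorphism $\varphi$ of $\mathcal{O}$. Theorem (Formal Structure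 Theorem). Let $0\ne f\in\mathcal{O}$ be not a product with a smooth factor, that is, $\mathrm{Der}_f\subseteq\mathfrak{m}\cdot\mathrm{Der}$. Let $s$ be the maximum, over all $g$ formally contact equivalent to $f$, of the dimension of the $\mathbb{C}$-vector space of diagonal $\sigma\in\mathrm{Der}_g$ with $\sigma(g)\in\mathbb{C}\cdot g$ (this maximum exists). Then, after a formal coordinate change and multiplication of $f$ by a unit, there are $\sigma_1,\dots,\sigma_s,\nu_1,\dots,\nu_r\in\mathrm{Der}_f$ and pairwise non-associated irreducible $f_1,\dots,f_m\in\mathcal{O}$ with $f=f_1^{l_1}\cdots f_m^{l_m}$, $l_j\ge1$, such that 1. $\sigma_1,\dots,\sigma_s,\nu_1,\dots,\nu_r$ is a minimal system of generators of the $\mathcal{O}$-module $\mathrm{Der}_f$; 2. if $\delta\in\mathrm{Der}_f$ satisfies $[\sigma_i,\delta]=0$ for all $i$, then $\delta_S\in\langle\sigma_1,\dots,\sigma_s\rangle_{\mathbb{C}}$; 3. every $\sigma_i$ is diagonal with eigenvalues in $\mathbb{Q}$; 4. every $\nu_j$ is nilpotent; 5. $[\sigma_i,\nu_j]\in\mathbb{Q}\cdot\nu_j$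 for all $i,j$; 6. $\sigma_i(f_j)\in\mathbb{Q}\cdot f_j$ for all $i,j$. -/

import Mathlib

noncomputable section

namespace FormalVectorField

/-- The ring `ℂ⟦x₁, …, xₙ⟧` of formal power series. -/
abbrev PS (n : ℕ) : Type := MvPowerSeries (Fin n) ℂ

/-- Formal vector fields: the `ℂ`-linear derivations of `ℂ⟦x₁, …, xₙ⟧`. -/
abbrev VF (n : ℕ) : Type := Derivation ℂ (PS n) (PS n)

variable {n : ℕ}

/-- The submodule `𝔪 · Der` of vector fields vanishing at the origin. -/
def vanishing (n : ℕ) : Submodule (PS n) (VF n) :=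
  IsLocalRing.maximalIdeal (PS n) • (⊤ : Submodule (PS n) (VF n))

/-- The module `Der_f` of logarithmic vector fields: all `δ` with `δ(𝒪 f) ⊆ 𝒪 f`. -/
def logDer (f : PS n) : Submodule (PS n) (VF n) where
  carrier := {δ | ∀ h ∈ Ideal.span {f}, δ h ∈ Ideal.span {f}}
  zero_mem' := fun h _ => by simp
  add_mem' := fun ha hb h hh => by
    rw [Derivation.add_apply]
    exact Ideal.add_mem _ (ha h hh) (hb h hh)
  smul_mem' := fun c δ hδ h hh => by
    rw [Derivation.smul_apply, smul_eq_mul]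
    exact Ideal.mul_mem_left _ c (hδ h hh)

/-- `f` is a product (with a smooth factor) if `Der_f ⊄ 𝔪 · Der`. -/
def IsProduct (f : PS n) : Prop := ¬ logDer f ≤ vanishing n

/-- Formal contact equivalence: equality up to a coordinate change and a unit factor.
Formal coordinate changes are the `ℂ`-algebra automorphisms of `ℂ⟦x₁, …, xₙ⟧`; the new
coordinates are the images of the variables. -/
def ContactEquiv (f g : PS n) : Prop :=
  ∃ φ : PS n ≃ₐ[ℂ] PS n, ∃ u : (PS n)ˣ, g = (u : PS n) * φ f

/-- The linear vector field `∑ᵢⱼ Aᵢⱼ xᵢ ∂ⱼ`. -/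
def linearField (A : Matrix (Fin n) (Fin n) ℂ) : VF n :=
  ∑ i, ∑ j, A i j • ((MvPowerSeries.X i : PS n) • (MvPowerSeries.pderiv ℂ j : VF n))

/-- The matrix `A` with `δ₀ = ∑ᵢⱼ Aᵢⱼ xᵢ ∂ⱼ`, where `δ₀` is the homogeneous part of degree `0`
of the vector field `δ`: `Aᵢⱼ` is the coefficient of `xᵢ` in `δ(xⱼ)`. -/
def linearMatrix : VF n →ₗ[ℂ] Matrix (Fin n) (Fin n) ℂ where
  toFun δ := Matrix.of fun i j =>
    MvPowerSeries.coeff (Finsupp.single i 1) (δ (MvPowerSeries.X j : PS n))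
  map_add' := fun a b => by ext i j; simp
  map_smul' := fun c a => by ext i j; simp

/-- `δ = δ₀` with semisimple matrix. -/
def IsSemisimpleField (δ : VF n) : Prop :=
  δ = linearField (linearMatrix δ) ∧ Module.End.IsSemisimple (Matrix.toLin' (linearMatrix δ))

/-- `δ ∈ 𝔪 · Der`, and the matrix of `δ₀` is nilpotent. -/
def IsNilpotentField (δ : VF n) : Prop :=
  δ ∈ vanishing n ∧ IsNilpotent (linearMatrix δ)

/-- `δ = δ₀` with diagonal matrix. -/
def IsDiagonalField (δ : VF n) : Prop :=
  δ = linearField (linearMatrix δ) ∧ (linearMatrix δ).IsDiag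

/-- `S` is the semisimple part `δ_S` of `δ`, i.e. `δ = S + N` with `S` semisimple, `N` nilpotent
and `[S₀, N₀] = 0`. -/
def IsSemisimplePart (S δ : VF n) : Prop :=
  ∃ N : VF n, δ = S + N ∧ IsSemisimpleField S ∧ IsNilpotentField N ∧
    ⁅linearField (linearMatrix S), linearField (linearMatrix N)⁆ = 0

theorem linearField_add (A B : Matrix (Fin n) (Fin n) ℂ) :
    linearField (A + B) = linearField A + linearField B := by
  simp [linearField, add_smul, Finset.sum_add_distrib]

theorem linearField_smul (c : ℂ) (A : Matrix (Fin n) (Fin n) ℂ) :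
    linearField (c • A) = c • linearField A := by
  simp [linearField, Finset.smul_sum, mul_smul]

/-- The `ℂ`-vector space of diagonal `σ ∈ Der_g` with `σ(g) ∈ ℂ · g`. -/
def diagonalLog (g : PS n) : Submodule ℂ (VF n) where
  carrier := {σ | σ ∈ logDer g ∧ IsDiagonalField σ ∧ ∃ c : ℂ, σ g = c • g}
  zero_mem' := ⟨zero_mem _, ⟨by simp [linearField], by simp [Matrix.IsDiag, Pairwise]⟩, 0, by simp⟩
  add_mem' := by
    rintro a b ⟨ha, ⟨ha1, ha2⟩, c, hc⟩ ⟨hb, ⟨hb1, hb2⟩, d, hd⟩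
    refine ⟨add_mem ha hb, ⟨?_, ?_⟩, c + d, ?_⟩
    · rw [map_add, linearField_add, ← ha1, ← hb1]
    · rw [map_add]; exact ha2.add hb2
    · rw [Derivation.add_apply, hc, hd, add_smul]
  smul_mem' := by
    rintro e a ⟨ha, ⟨ha1, ha2⟩, c, hc⟩
    refine ⟨?_, ⟨?_, ?_⟩, e * c, ?_⟩
    · intro h hh
      rw [Derivation.smul_apply, MvPowerSeries.smul_eq_C_mul]
      exact Ideal.mul_mem_left _ _ (ha h hh)
    · rw [map_smul, linearField_smul, ← ha1]
    · rw [map_smul]; exact ha2.smul e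
    · rw [Derivation.smul_apply, hc, mul_smul]

/-- The dimensions of the spaces of diagonal `σ ∈ Der_g` with `σ(g) ∈ ℂ · g`, for `g` varying in
the formal contact equivalence class of `f`. -/
def diagonalDims (f : PS n) : Set ℕ :=
  {d | ∃ g : PS n, ContactEquiv f g ∧ d = Module.finrank ℂ (diagonalLog g)}

/-- The family `v` generates `N`, and no proper subfamily does. -/
def IsMinimalGenerators {R M ι : Type*} [CommRing R] [AddCommGroup M] [Module R M]
    (v : ι → M) (N : Submodule R M) : Prop :=
  Submodule.span R (Set.range v) = N ∧
    ∀ T : Set ι, Submodule.span R (v '' T) = N → T = Set.univ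

/-- `p₁, …, pₘ` are the irreducible factors of `g`, without repetitions: they are irreducible and
pairwise non-associated, and `g = p₁ ^ l₁ ⋯ pₘ ^ lₘ` with positive exponents. -/
def AreIrreducibleFactors {m : ℕ} (p : Fin m → PS n) (g : PS n) : Prop :=
  (∀ j, Irreducible (p j)) ∧ (∀ j k, j ≠ k → ¬ Associated (p j) (p k)) ∧
    ∃ l : Fin m → ℕ, (∀ j, 0 < l j) ∧ g = ∏ j, p j ^ l j

end FormalVectorField

end

open FormalVectorField

noncomputable section

namespace FormalVectorField

open MvPowerSeries IsLocalRing

variable {n : ℕ}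

/-! Choose `g` in the contact class of `f` whose space of diagonal symmetries has the largest
dimension; dimensions are bounded because a diagonal field is determined by its matrix. A diagonal
field is a symmetry of `g` exactly when all monomials of `g` have the same weight. This is a system
of linear equations with integral coefficients, so there is a basis `σ` with rational eigenvalues
(`exists_rational_basis_diagonalLog`).

The heart is `exists_isSemisimplePart_mem_diagonalLog`. Let `δ` be logarithmic and commute with all
diagonal symmetries. Formal generalized eigenspaces of `δ` on power series provide coordinates that
are generalized eigenfunctions of `δ` and homogeneous for the existing weights. In these coordinates
the ideal of `g` is stable under taking components for the eigenvalues of `δ`, hence generated by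
one such component. That component is homogeneous for the old symmetries, which remain diagonal, and
also for the diagonal field given by the eigenvalues of `δ`. By maximality the latter is not new: it
is already the image of a diagonal symmetry `S` of `g`, and `S` is the semisimple part of `δ`.

Since `g` is homogeneous, the homogeneous components of a logarithmic field are again logarithmic.
Those of nonzero weight are nilpotent; those of weight zero are a diagonal symmetry plus a nilpotent
field of weight zero. Submodules are closed in the `𝔪`-adic topology, so these fields generate
(`logDer_le_span`). As `Der_g ⊆ 𝔪 · Der`, the `σ` stay independent modulo `𝔪 · Der_g`, and
Nakayama's lemma extends them to a minimal system of generators.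

Finally, a prime factor of `g` generates an ideal stable under the `σ`, so it is associated to a
homogeneous series. Replacing the factors changes `g` by a unit only, which leaves `Der_g` alone.
Factorization itself comes from unique factorization in power series rings, proved by Weierstrass
preparation. -/

/-! ### The `𝔪`-adic topology in terms of coefficients -/

theorem mem_maximalIdeal_iff {h : PS n} : h ∈ maximalIdeal (PS n) ↔ constantCoeff h = 0 := by
  rw [mem_maximalIdeal, mem_nonunits_iff, MvPowerSeries.isUnit_iff_constantCoeff,
    isUnit_iff_ne_zero, not_not]

theorem X_mem_maximalIdeal (i : Fin n) : (X i : PS n) ∈ maximalIdeal (PS n) := by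
  rw [mem_maximalIdeal_iff, constantCoeff_X]

theorem coeff_eq_zero_of_mem_pow {k : ℕ} {h : PS n} (hh : h ∈ maximalIdeal (PS n) ^ k)
    {α : Fin n →₀ ℕ} (hα : α.degree < k) : coeff α h = 0 := by
  suffices (k : ℕ∞) ≤ h.order from coeff_of_lt_order (lt_of_lt_of_le (by exact_mod_cast hα) this)
  clear hα
  induction k generalizing h with
  | zero => simp
  | succ k ih =>
    rw [pow_succ] at hh
    refine Submodule.mul_induction_on hh (fun a ha b hb => ?_) (fun a b ha hb => ?_)
    · refine le_trans ?_ le_order_mul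
      push_cast
      refine add_le_add (ih ha) ?_
      rw [one_le_order_iff_constCoeff_eq_zero]
      exact mem_maximalIdeal_iff.1 hb
    · exact le_trans (le_min ha hb) min_order_le_add

/-- The part of `h` divisible by `xᵢ` and not involving `xⱼ`, `j < i`, divided by `xᵢ`. -/
def firstQuotient (i : Fin n) (h : PS n) : PS n := fun β =>
  if ∀ j < i, β j = 0 then coeff (β + Finsupp.single i 1) h else 0

theorem coeff_firstQuotient (i : Fin n) (h : PS n) (β : Fin n →₀ ℕ) :
    coeff β (firstQuotient i h) =
      if ∀ j < i, β j = 0 then coeff (β + Finsupp.single i 1) h else 0 := rfl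

/-- Each nonconstant monomial is assigned to the smallest variable dividing it, so the summands have
disjoint supports. -/
theorem eq_sum_X_mul_firstQuotient {h : PS n} (h0 : constantCoeff h = 0) :
    h = ∑ i, X i * firstQuotient i h := by
  ext α
  rw [map_sum]
  have hX : ∀ i, coeff α (X i * firstQuotient i h) =
      if α i ≠ 0 ∧ ∀ j < i, α j = 0 then coeff α h else 0 := by
    intro i
    rw [X, coeff_monomial_mul]
    have hle : Finsupp.single i 1 ≤ α ↔ α i ≠ 0 := by
      rw [Finsupp.single_le_iff]; omega
    by_cases hi : α i ≠ 0
    · rw [if_pos (hle.2 hi), one_mul, coeff_firstQuotient, tsub_add_cancel_of_le (hle.2 hi)]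
      have : (∀ j < i, (α - Finsupp.single i 1 : Fin n →₀ ℕ) j = 0) ↔ ∀ j < i, α j = 0 := by
        refine forall₂_congr fun j hj => ?_
        rw [Finsupp.tsub_apply, Finsupp.single_eq_of_ne (by exact hj.ne)]
        simp
      simp only [this, hi, ne_eq, not_false_eq_true, true_and]
    · simp [hi, hle]
  simp_rw [hX]
  by_cases hα : α = 0
  · subst hα
    simpa using h0
  · have hne : (α.support).Nonempty := Finsupp.support_nonempty_iff.2 hα
    obtain ⟨i, hi, hmin⟩ := α.support.exists_minimal hne
    have hmin' : ∀ j < i, α j = 0 := by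
      intro j hj
      by_contra hc
      exact absurd (hmin (Finsupp.mem_support_iff.2 hc) hj.le) (not_le.2 hj)
    rw [Finset.sum_eq_single i]
    · rw [if_pos ⟨Finsupp.mem_support_iff.1 hi, hmin'⟩]
    · intro j _ hji
      rw [if_neg]
      rintro ⟨h1, h2⟩
      rcases lt_or_gt_of_ne hji with hlt | hlt
      · exact h1 (hmin' j hlt)
      · exact Finsupp.mem_support_iff.1 hi (h2 i hlt)
    · simp

theorem mem_pow_iff {k : ℕ} {h : PS n} :
    h ∈ maximalIdeal (PS n) ^ k ↔ ∀ α : Fin n →₀ ℕ, α.degree < k → coeff α h = 0 := by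
  refine ⟨fun hh α hα => coeff_eq_zero_of_mem_pow hh hα, ?_⟩
  induction k generalizing h with
  | zero => simp
  | succ k ih =>
    intro hh
    have h0 : constantCoeff h = 0 := by
      rw [← coeff_zero_eq_constantCoeff_apply]; exact hh 0 (by simp)
    rw [eq_sum_X_mul_firstQuotient h0, pow_succ']
    refine sum_mem fun i _ => Ideal.mul_mem_mul (X_mem_maximalIdeal i) (ih fun β hβ => ?_)
    rw [coeff_firstQuotient]
    split_ifs
    · exact hh _ (by simpa using hβ)
    · rfl

theorem span_range_X : Ideal.span (Set.range X) = maximalIdeal (PS n) := by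
  apply le_antisymm
  · rw [Ideal.span_le]
    rintro _ ⟨i, rfl⟩
    exact X_mem_maximalIdeal i
  · intro h hh
    rw [eq_sum_X_mul_firstQuotient (mem_maximalIdeal_iff.1 hh)]
    exact sum_mem fun i _ => Ideal.mul_mem_right _ _ (Ideal.subset_span ⟨i, rfl⟩)

instance : IsAdicComplete (maximalIdeal (PS n)) (PS n) := by
  rw [← span_range_X]; infer_instance

theorem eq_zero_of_forall_mem_pow {h : PS n} (hh : ∀ k, h ∈ maximalIdeal (PS n) ^ k) : h = 0 := by
  ext α
  exact mem_pow_iff.1 (hh (α.degree + 1)) α (Nat.lt_succ_self _)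

/-- Submodules of finitely generated modules over a Noetherian local ring are closed. -/
theorem mem_of_forall_mem_sup {R M : Type*} [CommRing R] [IsNoetherianRing R] [IsLocalRing R]
    [AddCommGroup M] [Module R M] [Module.Finite R M] {N : Submodule R M} {x : M}
    (hx : ∀ k : ℕ, x ∈ N ⊔ maximalIdeal R ^ k • (⊤ : Submodule R M)) : x ∈ N := by
  rw [← Submodule.Quotient.mk_eq_zero]
  -- Krull's intersection theorem for the finite module `M ⧸ N`.
  have h : IsHausdorff (maximalIdeal R) (M ⧸ N) := inferInstance
  refine h.haus _ fun k => ?_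
  rw [SModEq.zero]
  obtain ⟨y, hy, z, hz, rfl⟩ := Submodule.mem_sup.1 (hx k)
  rw [Submodule.Quotient.mk_add, (Submodule.Quotient.mk_eq_zero N).2 hy, zero_add]
  have := Submodule.mem_map_of_mem (f := N.mkQ) hz
  rw [Submodule.map_smul''] at this
  exact Submodule.smul_mono le_rfl le_top this

theorem mem_ideal_of_forall_mem_sup {J : Ideal (PS n)} {h : PS n}
    (hh : ∀ k : ℕ, h ∈ J ⊔ maximalIdeal (PS n) ^ k) : h ∈ J :=
  mem_of_forall_mem_sup fun k => by simpa using hh k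

/-! ### Derivations of the power series ring -/

theorem derivation_sum_apply {ι : Type*} (s : Finset ι) (D : ι → VF n) (h : PS n) :
    (∑ i ∈ s, D i) h = ∑ i ∈ s, D i h := by
  rw [← Derivation.coeFnAddMonoidHom_apply, map_sum, Finset.sum_apply]
  rfl

theorem derivation_pow_mem (D : VF n) {k : ℕ} {h : PS n}
    (hh : h ∈ maximalIdeal (PS n) ^ (k + 1)) : D h ∈ maximalIdeal (PS n) ^ k := by
  induction k generalizing h with
  | zero => simp
  | succ k ih =>
    rw [pow_succ'] at hh
    refine Submodule.mul_induction_on hh (fun a ha b hb => ?_) (fun a b ha hb => ?_)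
    · rw [Derivation.leibniz, smul_eq_mul, smul_eq_mul]
      refine add_mem ?_ (Ideal.mul_mem_right _ _ hb)
      rw [pow_succ']
      exact Ideal.mul_mem_mul ha (ih hb)
    · rw [map_add]; exact add_mem ha hb

theorem sub_truncTotal_mem (k : ℕ) (h : PS n) :
    h - (truncTotal k h : MvPolynomial (Fin n) ℂ) ∈ maximalIdeal (PS n) ^ k := by
  rw [mem_pow_iff]
  intro α hα
  rw [map_sub, MvPolynomial.coeff_coe, coeff_truncTotal _ hα, sub_self]

/-- Continuity is automatic: a derivation lowers the `𝔪`-adic order by at most one, so one that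
kills the variables, hence all polynomials, is zero. -/
theorem derivation_ext {D₁ D₂ : VF n} (hD : ∀ j, D₁ (X j) = D₂ (X j)) : D₁ = D₂ := by
  ext1 h
  rw [← sub_eq_zero]
  change (D₁ - D₂) h = 0
  have hX : ∀ j, (D₁ - D₂) (X j) = 0 := fun j => by simp [hD]
  generalize D₁ - D₂ = D at hX
  have hpoly : ∀ p : MvPolynomial (Fin n) ℂ, D (p : PS n) = 0 := by
    intro p
    induction p using MvPolynomial.induction_on with
    | C a =>
      rw [MvPolynomial.coe_C]
      exact D.map_algebraMap a
    | add p q hp hq => rw [MvPolynomial.coe_add, map_add, hp, hq, add_zero]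
    | mul_X p i hp => rw [MvPolynomial.coe_mul, Derivation.leibniz, hp, MvPolynomial.coe_X, hX]; simp
  refine eq_zero_of_forall_mem_pow fun k => ?_
  have := derivation_pow_mem D (sub_truncTotal_mem (k + 1) h)
  rwa [map_sub, hpoly, sub_zero] at this

theorem derivation_eq_sum (D : VF n) :
    D = ∑ j, D (X j) • (pderiv ℂ j : VF n) := by
  refine derivation_ext fun j => ?_
  rw [derivation_sum_apply, Finset.sum_eq_single j]
  · rw [Derivation.smul_apply, pderiv_X_self, smul_eq_mul, mul_one]
  · intro i _ hij
    rw [Derivation.smul_apply, pderiv_X_of_ne hij.symm, smul_zero]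
  · simp

theorem derivation_apply_eq_sum (D : VF n) (h : PS n) :
    D h = ∑ j, D (X j) * pderiv ℂ j h := by
  conv_lhs => rw [derivation_eq_sum D]
  rw [derivation_sum_apply]
  rfl

instance : Module.Finite (PS n) (VF n) := by
  refine ⟨Submodule.fg_def.2 ⟨Set.range fun j => (pderiv ℂ j : VF n), Set.finite_range _, ?_⟩⟩
  rw [eq_top_iff]
  intro D _
  rw [derivation_eq_sum D]
  exact sum_mem fun j _ => Submodule.smul_mem _ _ (Submodule.subset_span ⟨j, rfl⟩)

theorem mem_pow_smul_top_iff {k : ℕ} {D : VF n} :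
    D ∈ maximalIdeal (PS n) ^ k • (⊤ : Submodule (PS n) (VF n)) ↔
      ∀ j, D (X j) ∈ maximalIdeal (PS n) ^ k := by
  constructor
  · intro hD j
    refine Submodule.smul_induction_on hD (fun a ha b _ => ?_) (fun a b ha hb => ?_)
    · exact Ideal.mul_mem_right _ _ ha
    · exact add_mem ha hb
  · intro hD
    rw [derivation_eq_sum D]
    exact sum_mem fun j _ => Submodule.smul_mem_smul (hD j) trivial

theorem mem_vanishing_iff {D : VF n} :
    D ∈ vanishing n ↔ ∀ j, D (X j) ∈ maximalIdeal (PS n) := by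
  simpa [vanishing] using mem_pow_smul_top_iff (k := 1) (D := D)

theorem apply_mem_of_mem_vanishing {D : VF n} (hD : D ∈ vanishing n) {k : ℕ} {h : PS n}
    (hh : h ∈ maximalIdeal (PS n) ^ k) : D h ∈ maximalIdeal (PS n) ^ k := by
  rcases k with _ | k
  · simp
  rw [derivation_apply_eq_sum, pow_succ']
  exact sum_mem fun j _ => Ideal.mul_mem_mul (mem_vanishing_iff.1 hD j) (derivation_pow_mem _ hh)

/-! ### Linear parts and the action on `𝔪 / 𝔪²` -/

/-- The coefficients of the linear part of a power series. -/
def linCoeff (n : ℕ) : PS n →ₗ[ℂ] Fin n → ℂ :=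
  LinearMap.pi fun i => coeff (Finsupp.single i 1)

@[simp]
theorem linCoeff_apply (h : PS n) (i : Fin n) :
    linCoeff n h i = coeff (Finsupp.single i 1) h := rfl

theorem linCoeff_X (j : Fin n) : linCoeff n (X j) = Pi.single j 1 := by
  ext i
  rw [linCoeff_apply, coeff_X, Pi.single_apply]
  simp [Finsupp.single_left_inj]

theorem mem_sq_iff {h : PS n} (h0 : h ∈ maximalIdeal (PS n)) :
    h ∈ maximalIdeal (PS n) ^ 2 ↔ linCoeff n h = 0 := by
  rw [mem_pow_iff]
  constructor
  · intro hh
    ext i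
    exact hh _ (by simp)
  · intro hh α hα
    rcases Nat.lt_succ_iff_lt_or_eq.1 hα with h1 | h1
    · rw [Nat.lt_one_iff, Finsupp.degree_eq_zero_iff] at h1
      subst h1
      exact mem_maximalIdeal_iff.1 h0
    · obtain ⟨i, rfl⟩ : ∃ i, α = Finsupp.single i 1 := by
        exact (Finsupp.sum_eq_one_iff α).1 h1
      exact congrFun hh i

theorem linCoeff_mul (a b : PS n) :
    linCoeff n (a * b) = constantCoeff a • linCoeff n b + constantCoeff b • linCoeff n a := by
  ext i
  simp only [linCoeff_apply, Pi.add_apply, Pi.smul_apply, smul_eq_mul]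
  rw [coeff_mul, Finsupp.antidiagonal_single]
  simp [Finset.Nat.antidiagonal_succ, mul_comm]

theorem linCoeff_derivation {D : VF n} (hD : D ∈ vanishing n) (h : PS n) :
    linCoeff n (D h) = (linearMatrix D).mulVec (linCoeff n h) := by
  rw [derivation_apply_eq_sum, map_sum]
  ext i
  rw [Finset.sum_apply, Matrix.mulVec, dotProduct]
  refine Finset.sum_congr rfl fun j _ => ?_
  rw [linCoeff_mul, mem_maximalIdeal_iff.1 (mem_vanishing_iff.1 hD j), zero_smul, zero_add,
    ← coeff_zero_eq_constantCoeff_apply, coeff_pderiv]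
  simp [linearMatrix, mul_comm]

theorem linearField_apply_X (A : Matrix (Fin n) (Fin n) ℂ) (j : Fin n) :
    linearField A (X j) = ∑ i, A i j • (X i : PS n) := by
  rw [linearField, derivation_sum_apply]
  refine Finset.sum_congr rfl fun i _ => ?_
  rw [derivation_sum_apply, Finset.sum_eq_single j]
  · simp [pderiv_X_self]
  · intro k _ hk
    simp [pderiv_X_of_ne hk.symm]
  · simp

theorem linearMatrix_linearField (A : Matrix (Fin n) (Fin n) ℂ) :
    linearMatrix (linearField A) = A := by
  ext i j
  change linCoeff n (linearField A (X j)) i = A i j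
  rw [linearField_apply_X, map_sum, Finset.sum_apply]
  simp only [map_smul, linCoeff_X]
  simp [Pi.single_apply]

theorem linearField_mem_vanishing (A : Matrix (Fin n) (Fin n) ℂ) :
    linearField A ∈ vanishing n := by
  rw [mem_vanishing_iff]
  intro j
  rw [linearField_apply_X]
  refine sum_mem fun i _ => ?_
  rw [smul_eq_C_mul]
  exact Ideal.mul_mem_left _ _ (X_mem_maximalIdeal i)

/-! ### Diagonal fields and logarithmic fields -/

/-- The diagonal vector field `∑ dᵢ xᵢ ∂ᵢ`. -/
def diagonalField (d : Fin n → ℂ) : VF n := linearField (Matrix.diagonal d)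

theorem diagonalField_apply_X (d : Fin n → ℂ) (j : Fin n) :
    diagonalField d (X j) = d j • (X j : PS n) := by
  rw [diagonalField, linearField_apply_X, Finset.sum_eq_single j]
  · simp
  · intro i _ hij
    simp [Matrix.diagonal_apply_ne _ hij]
  · simp

theorem linearMatrix_diagonalField (d : Fin n → ℂ) :
    linearMatrix (diagonalField d) = Matrix.diagonal d := linearMatrix_linearField _

theorem isDiagonalField_diagonalField (d : Fin n → ℂ) : IsDiagonalField (diagonalField d) := by
  rw [IsDiagonalField, linearMatrix_diagonalField]
  exact ⟨rfl, Matrix.isDiag_diagonal d⟩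

theorem IsDiagonalField.eq_diagonalField {σ : VF n} (hσ : IsDiagonalField σ) :
    σ = diagonalField (linearMatrix σ).diag := by
  rw [diagonalField, hσ.2.diagonal_diag]
  exact hσ.1

/-- The weight `∑ dᵢ αᵢ` of the monomial `x ^ α`. -/
def wt (d : Fin n → ℂ) (α : Fin n →₀ ℕ) : ℂ := ∑ i, d i * α i

theorem wt_add (d : Fin n → ℂ) (α β : Fin n →₀ ℕ) : wt d (α + β) = wt d α + wt d β := by
  simp [wt, mul_add, Finset.sum_add_distrib]

theorem wt_single (d : Fin n → ℂ) (j : Fin n) : wt d (Finsupp.single j 1) = d j := by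
  rw [wt, Finset.sum_eq_single j]
  · simp
  · intro i _ hij
    simp [Finsupp.single_eq_of_ne hij]
  · simp

theorem coeff_diagonalField (d : Fin n → ℂ) (h : PS n) (α : Fin n →₀ ℕ) :
    coeff α (diagonalField d h) = wt d α * coeff α h := by
  rw [derivation_apply_eq_sum, map_sum, wt, Finset.sum_mul]
  refine Finset.sum_congr rfl fun j _ => ?_
  rw [diagonalField_apply_X, smul_mul_assoc, coeff_smul, X, coeff_monomial_mul, one_mul]
  by_cases hj : α j = 0
  · have : ¬ Finsupp.single j 1 ≤ α := by rw [Finsupp.single_le_iff]; omega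
    simp [hj, this]
  · have : Finsupp.single j 1 ≤ α := by rw [Finsupp.single_le_iff]; omega
    rw [if_pos this, coeff_pderiv, tsub_add_cancel_of_le this]
    rw [Finsupp.tsub_apply, Finsupp.single_eq_same, Nat.cast_sub (by omega)]
    simp
    ring

theorem diagonalField_add (d e : Fin n → ℂ) :
    diagonalField (d + e) = diagonalField d + diagonalField e := by
  rw [diagonalField, diagonalField, diagonalField, ← linearField_add, Matrix.diagonal_add]; rfl

theorem diagonalField_smul (c : ℂ) (d : Fin n → ℂ) :
    diagonalField (c • d) = c • diagonalField d := by
  rw [diagonalField, diagonalField, ← linearField_smul, Matrix.diagonal_smul]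

instance : IsDomain (PS n) := NoZeroDivisors.to_isDomain _

theorem mem_logDer_iff {f : PS n} {D : VF n} : D ∈ logDer f ↔ f ∣ D f := by
  change (∀ h ∈ Ideal.span {f}, D h ∈ Ideal.span {f}) ↔ _
  simp_rw [Ideal.mem_span_singleton]
  refine ⟨fun h => h f dvd_rfl, ?_⟩
  rintro h _ ⟨a, rfl⟩
  rw [Derivation.leibniz, smul_eq_mul, smul_eq_mul]
  exact dvd_add (dvd_mul_right _ _) (h.mul_left _)

theorem logDer_eq_of_associated {f g : PS n} (h : Associated f g) : logDer f = logDer g := by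
  ext D
  change (∀ h ∈ Ideal.span {f}, D h ∈ Ideal.span {f}) ↔ (∀ h ∈ Ideal.span {g}, D h ∈ Ideal.span {g})
  rw [Ideal.span_singleton_eq_span_singleton.2 h]

/-! ### Gradings by weights in an abelian group -/

section Weights

variable {Γ : Type*} [AddCommGroup Γ] (ω : (Fin n →₀ ℕ) →+ Γ)

/-- All monomials of `h` have weight in `A`. -/
def SupportedIn (A : Set Γ) (h : PS n) : Prop := ∀ α, coeff α h ≠ 0 → ω α ∈ A

/-- `h` is homogeneous of weight `c`. -/
abbrev IsHomog (c : Γ) (h : PS n) : Prop := SupportedIn ω {c} h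

open Classical in
/-- The component of weight `c`. -/
def comp (c : Γ) : PS n →ₗ[ℂ] PS n where
  toFun h := fun α => if ω α = c then coeff α h else 0
  map_add' a b := by
    ext α
    change (if ω α = c then coeff α (a + b) else 0) =
      (if ω α = c then coeff α a else 0) + (if ω α = c then coeff α b else 0)
    split_ifs <;> simp
  map_smul' a b := by
    ext α
    change (if ω α = c then coeff α (a • b) else 0) =
      a • (if ω α = c then coeff α b else 0)
    split_ifs <;> simp

open Classical in
theorem coeff_comp (c : Γ) (h : PS n) (α : Fin n →₀ ℕ) :
    coeff α (comp ω c h) = if ω α = c then coeff α h else 0 := rfl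

variable {ω}

theorem isHomog_comp (c : Γ) (h : PS n) : IsHomog ω c (comp ω c h) := by
  intro α hα
  rw [coeff_comp] at hα
  by_contra hc
  exact hα (if_neg hc)

theorem comp_of_supportedIn {A : Set Γ} {c : Γ} (hc : c ∉ A) {h : PS n} (hh : SupportedIn ω A h) :
    comp ω c h = 0 := by
  ext α
  rw [coeff_comp, map_zero]
  split_ifs with hα
  · by_contra h0
    exact hc (hα ▸ hh α h0)
  · rfl

theorem IsHomog.comp_eq {c : Γ} {h : PS n} (hh : IsHomog ω c h) : comp ω c h = h := by
  ext α
  rw [coeff_comp]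
  split_ifs with hα
  · rfl
  · by_contra h0
    exact hα (hh α (Ne.symm h0))

/-- Products and derivations are controlled by following the remainder as a series avoiding one
weight; this is why supports in arbitrary sets of weights are allowed. -/
theorem supportedIn_sub_comp (c : Γ) (h : PS n) : SupportedIn ω {c}ᶜ (h - comp ω c h) := by
  intro α hα
  rw [map_sub, coeff_comp] at hα
  intro hc
  rw [Set.mem_singleton_iff] at hc
  simp [hc] at hα

theorem SupportedIn.add {A : Set Γ} {a b : PS n} (ha : SupportedIn ω A a)
    (hb : SupportedIn ω A b) : SupportedIn ω A (a + b) := by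
  intro α hα
  by_cases h : coeff α a = 0
  · exact hb α (by simpa [h] using hα)
  · exact ha α h

theorem supportedIn_zero (A : Set Γ) : SupportedIn ω A 0 := fun _ hα => absurd (map_zero _) hα

theorem supportedIn_sum {A : Set Γ} {ι : Type*} (s : Finset ι) {a : ι → PS n}
    (ha : ∀ i ∈ s, SupportedIn ω A (a i)) : SupportedIn ω A (∑ i ∈ s, a i) :=
  Finset.sum_induction _ (SupportedIn ω A) (fun _ _ => SupportedIn.add) (supportedIn_zero A) ha

theorem SupportedIn.mul {A B C : Set Γ} (hC : ∀ a ∈ A, ∀ b ∈ B, a + b ∈ C) {a b : PS n}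
    (ha : SupportedIn ω A a) (hb : SupportedIn ω B b) : SupportedIn ω C (a * b) := by
  intro α hα
  rw [coeff_mul] at hα
  obtain ⟨⟨β, γ⟩, hβγ, h0⟩ := Finset.exists_ne_zero_of_sum_ne_zero hα
  rw [Finset.HasAntidiagonal.mem_antidiagonal] at hβγ
  rw [← hβγ, map_add]
  exact hC _ (ha _ (left_ne_zero_of_mul h0)) _ (hb _ (right_ne_zero_of_mul h0))

theorem SupportedIn.pderiv {A : Set Γ} {h : PS n} (hh : SupportedIn ω A h) (j : Fin n) :
    SupportedIn ω {c | c + ω (Finsupp.single j 1) ∈ A} (MvPowerSeries.pderiv ℂ j h) := by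
  intro α hα
  rw [coeff_pderiv] at hα
  rw [Set.mem_ofPred_eq, ← map_add]
  exact hh _ (left_ne_zero_of_mul hα)

/-- Multiplication by `b` translates weights by `c`, so the part of `a` avoiding `w` contributes
nothing in weight `w + c`. -/
theorem comp_mul {c : Γ} (w : Γ) (a : PS n) {b : PS n} (hb : IsHomog ω c b) :
    comp ω (w + c) (a * b) = comp ω w a * b := by
  have h1 : IsHomog ω (w + c) (comp ω w a * b) :=
    (isHomog_comp w a).mul (fun x hx y hy => by rw [hx, hy]; rfl) hb
  have h2 : SupportedIn ω {w + c}ᶜ ((a - comp ω w a) * b) := by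
    refine (supportedIn_sub_comp w a).mul (fun x hx y hy => ?_) hb
    rw [hy]
    simpa using hx
  rw [← h1.comp_eq, ← sub_eq_zero, ← map_sub, ← sub_mul]
  exact comp_of_supportedIn (by simp) h2

theorem comp_mem_pow (c : Γ) {k : ℕ} {h : PS n} (hh : h ∈ maximalIdeal (PS n) ^ k) :
    comp ω c h ∈ maximalIdeal (PS n) ^ k := by
  rw [mem_pow_iff] at hh ⊢
  intro α hα
  rw [coeff_comp, hh α hα, ite_self]

variable (ω) in
theorem exists_finset_weights (k : ℕ) :
    ∃ F : Finset Γ, ∀ α : Fin n →₀ ℕ, α.degree < k → ω α ∈ F := by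
  classical
  refine ⟨(Finsupp.finite_of_degree_le (σ := Fin n) k).toFinset.image ω, fun α hα => ?_⟩
  exact Finset.mem_image_of_mem _ (by simpa using hα.le)

theorem sub_sum_comp_mem {k : ℕ} {F : Finset Γ}
    (hF : ∀ α : Fin n →₀ ℕ, α.degree < k → ω α ∈ F) (h : PS n) :
    h - ∑ c ∈ F, comp ω c h ∈ maximalIdeal (PS n) ^ k := by
  rw [mem_pow_iff]
  intro α hα
  rw [map_sub, map_sum, sub_eq_zero, Finset.sum_eq_single (ω α)]
  · rw [coeff_comp, if_pos rfl]
  · intro c _ hc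
    rw [coeff_comp, if_neg hc.symm]
  · exact fun h => absurd (hF α hα) h

variable (ω) in
/-- `D` is homogeneous of weight `w`. -/
def IsHomogDer (w : Γ) (D : VF n) : Prop :=
  ∀ j, IsHomog ω (w + ω (Finsupp.single j 1)) (D (X j))

theorem IsHomogDer.supportedIn {w : Γ} {D : VF n} (hD : IsHomogDer ω w D) {A : Set Γ} {h : PS n}
    (hh : SupportedIn ω A h) : SupportedIn ω {c | c - w ∈ A} (D h) := by
  rw [derivation_apply_eq_sum]
  refine supportedIn_sum _ fun j _ => (hD j).mul (fun a ha b hb => ?_) (hh.pderiv j)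
  rw [Set.mem_singleton_iff] at ha
  rw [Set.mem_ofPred_eq, ha]
  rw [Set.mem_ofPred_eq] at hb
  rwa [add_assoc, add_sub_cancel_left, add_comm]

theorem IsHomogDer.isHomog {w c : Γ} {D : VF n} (hD : IsHomogDer ω w D) {h : PS n}
    (hh : IsHomog ω c h) : IsHomog ω (w + c) (D h) := by
  intro α hα
  have := hD.supportedIn hh α hα
  rw [Set.mem_ofPred_eq, Set.mem_singleton_iff, sub_eq_iff_eq_add'] at this
  exact this

theorem IsHomogDer.comp_apply {D : VF n} (hD : IsHomogDer ω 0 D) (c : Γ) (h : PS n) :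
    comp ω c (D h) = D (comp ω c h) := by
  have h1 : IsHomog ω c (D (comp ω c h)) := by simpa using hD.isHomog (isHomog_comp c h)
  rw [← h1.comp_eq, ← sub_eq_zero, ← map_sub, ← map_sub]
  refine comp_of_supportedIn (A := {c}ᶜ) (by simp) ?_
  have := hD.supportedIn (supportedIn_sub_comp c h)
  simp only [sub_zero, Set.ofPred_mem_eq] at this
  exact this

variable (ω) in
/-- The component of weight `w` of a vector field. -/
def derivComp (w : Γ) (D : VF n) : VF n :=
  ∑ j, comp ω (w + ω (Finsupp.single j 1)) (D (X j)) • (pderiv ℂ j : VF n)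

theorem derivComp_apply_X (w : Γ) (D : VF n) (j : Fin n) :
    derivComp ω w D (X j) = comp ω (w + ω (Finsupp.single j 1)) (D (X j)) := by
  rw [derivComp, derivation_sum_apply, Finset.sum_eq_single j]
  · rw [Derivation.smul_apply, pderiv_X_self, smul_eq_mul, mul_one]
  · intro i _ hij
    rw [Derivation.smul_apply, pderiv_X_of_ne hij.symm, smul_zero]
  · simp

theorem isHomogDer_derivComp (w : Γ) (D : VF n) : IsHomogDer ω w (derivComp ω w D) := by
  intro j
  rw [derivComp_apply_X]
  exact isHomog_comp _ _

theorem derivComp_apply (w : Γ) (D : VF n) {c : Γ} {h : PS n} (hh : IsHomog ω c h) :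
    derivComp ω w D h = comp ω (w + c) (D h) := by
  rw [derivation_apply_eq_sum, derivation_apply_eq_sum D, map_sum]
  refine Finset.sum_congr rfl fun j _ => ?_
  have hj : IsHomog ω (c - ω (Finsupp.single j 1)) (pderiv ℂ j h) := by
    intro α hα
    rw [Set.mem_singleton_iff, eq_sub_iff_add_eq]
    exact hh.pderiv j α hα
  rw [derivComp_apply_X, ← comp_mul _ _ hj]
  congr 2
  abel

/-- Taking components of weight `w + c` in `D g = g * a` leaves `g` times the component of `a` of
weight `w`. -/
theorem derivComp_mem_logDer (w : Γ) {D : VF n} {c : Γ} {g : PS n} (hg : IsHomog ω c g)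
    (hD : D ∈ logDer g) : derivComp ω w D ∈ logDer g := by
  rw [mem_logDer_iff] at hD ⊢
  obtain ⟨a, ha⟩ := hD
  rw [derivComp_apply w D hg, ha, mul_comm, comp_mul w a hg]
  exact dvd_mul_left _ _

variable (ω) in
theorem exists_sub_sum_derivComp_mem (k : ℕ) (D : VF n) :
    ∃ F : Finset Γ, D - ∑ w ∈ F, derivComp ω w D ∈
      maximalIdeal (PS n) ^ k • (⊤ : Submodule (PS n) (VF n)) := by
  classical
  obtain ⟨F, hF⟩ := exists_finset_weights ω k
  -- These are the `w` for which `w` plus the weight of some `xⱼ` is the weight of a monomial of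
  -- degree below `k`; no other component matters modulo `𝔪 ^ k`.
  refine ⟨(F ×ˢ Finset.univ).image fun p : Γ × Fin n => p.1 - ω (Finsupp.single p.2 1), ?_⟩
  rw [mem_pow_smul_top_iff]
  intro j
  rw [Derivation.sub_apply, derivation_sum_apply]
  simp_rw [derivComp_apply_X]
  rw [← Finset.sum_image (f := fun c => comp ω c (D (X j)))
    (g := fun w => w + ω (Finsupp.single j 1)) (fun a _ b _ h => add_right_cancel h)]
  refine sub_sum_comp_mem (fun α hα => ?_) _
  rw [Finset.mem_image]
  refine ⟨ω α - ω (Finsupp.single j 1), ?_, sub_add_cancel _ _⟩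
  exact Finset.mem_image.2 ⟨(ω α, j), by simp [hF α hα], rfl⟩

end Weights

/-! ### Homogeneity as an eigenvector condition for diagonal fields -/

/-- The weight homomorphism `α ↦ ∑ dᵢ αᵢ`. -/
def wtHom (d : Fin n → ℂ) : (Fin n →₀ ℕ) →+ ℂ := AddMonoidHom.mk' (wt d) (wt_add d)

@[simp]
theorem wtHom_apply (d : Fin n → ℂ) (α : Fin n →₀ ℕ) : wtHom d α = wt d α := rfl

/-- The joint weight homomorphism of a family of diagonal fields. -/
def jointWt {ι : Type*} (d : ι → Fin n → ℂ) : (Fin n →₀ ℕ) →+ (ι → ℂ) :=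
  AddMonoidHom.mk' (fun α i => wt (d i) α) fun α β => by ext i; exact wt_add _ _ _

@[simp]
theorem jointWt_apply {ι : Type*} (d : ι → Fin n → ℂ) (α : Fin n →₀ ℕ) (i : ι) :
    jointWt d α i = wt (d i) α := rfl

theorem diagonalField_apply_eq_smul_iff {d : Fin n → ℂ} {c : ℂ} {h : PS n} :
    diagonalField d h = c • h ↔ IsHomog (wtHom d) c h := by
  constructor
  · intro hh α hα
    have := congrArg (coeff α) hh
    rw [coeff_diagonalField, coeff_smul] at this
    exact mul_right_cancel₀ hα this
  · intro hh
    ext α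
    rw [coeff_diagonalField, coeff_smul]
    by_cases h0 : coeff α h = 0
    · simp [h0]
    · rw [← wtHom_apply, hh α h0]

theorem isHomog_jointWt_iff {ι : Type*} {d : ι → Fin n → ℂ} {c : ι → ℂ} {h : PS n} :
    IsHomog (jointWt d) c h ↔ ∀ i, diagonalField (d i) h = c i • h := by
  simp_rw [diagonalField_apply_eq_smul_iff]
  constructor
  · intro hh i α hα
    exact congrFun (hh α hα) i
  · intro hh α hα
    ext i
    exact hh i α hα

theorem lie_diagonalField_eq_smul_iff {d : Fin n → ℂ} {c : ℂ} {D : VF n} :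
    ⁅diagonalField d, D⁆ = c • D ↔ IsHomogDer (wtHom d) c D := by
  have key : ∀ j, ⁅diagonalField d, D⁆ (X j) = c • D (X j) ↔
      IsHomog (wtHom d) (c + wtHom d (Finsupp.single j 1)) (D (X j)) := by
    intro j
    rw [← diagonalField_apply_eq_smul_iff, Derivation.commutator_apply, diagonalField_apply_X,
      D.map_smul, wtHom_apply, wt_single, add_smul, sub_eq_iff_eq_add]
  constructor
  · intro h j
    rw [← key, h, Derivation.smul_apply]
  · intro h
    exact derivation_ext fun j => by rw [(key j).2 (h j), Derivation.smul_apply]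

theorem isHomogDer_jointWt_iff {ι : Type*} {d : ι → Fin n → ℂ} {c : ι → ℂ} {D : VF n} :
    IsHomogDer (jointWt d) c D ↔ ∀ i, ⁅diagonalField (d i), D⁆ = c i • D := by
  simp_rw [lie_diagonalField_eq_smul_iff]
  constructor
  · intro hh i j α hα
    exact congrFun (hh j α hα) i
  · intro hh j α hα
    ext i
    exact hh i j α hα

/-- A nonzero entry `(i, j)` of the `m`-th power forces `d i - d j = m * w`. There are finitely many
differences and infinitely many multiples of `w ≠ 0`, so some power vanishes. -/
theorem isNilpotent_linearMatrix_of_isHomogDer {d : Fin n → ℂ} {w : ℂ} (hw : w ≠ 0) {D : VF n}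
    (hD : IsHomogDer (wtHom d) w D) : IsNilpotent (linearMatrix D) := by
  have h1 : ∀ i j, linearMatrix D i j ≠ 0 → d i = w + d j := by
    intro i j hij
    have := hD j (Finsupp.single i 1) hij
    simpa [wt_single] using this
  have h2 : ∀ (m : ℕ) i j, (linearMatrix D ^ m) i j ≠ 0 → d i = m * w + d j := by
    intro m
    induction m with
    | zero =>
      intro i j hij
      rw [pow_zero, Matrix.one_apply] at hij
      by_cases h : i = j
      · simp [h]
      · simp [h] at hij
    | succ m ih =>
      intro i j hij
      rw [pow_succ, Matrix.mul_apply] at hij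
      obtain ⟨k, _, hk⟩ := Finset.exists_ne_zero_of_sum_ne_zero hij
      rw [ih i k (left_ne_zero_of_mul hk), h1 k j (right_ne_zero_of_mul hk)]
      push_cast
      ring
  have hinj : Function.Injective fun m : ℕ => (m : ℂ) * w := by
    intro a b h
    exact_mod_cast mul_right_cancel₀ hw h
  obtain ⟨_, ⟨m, rfl⟩, hm⟩ := (Set.infinite_range_of_injective hinj).exists_notMem_finite
    (Set.finite_range fun p : Fin n × Fin n => d p.1 - d p.2)
  refine ⟨m, ?_⟩
  ext i j
  by_contra h
  exact hm ⟨(i, j), by simp [h2 m i j h]⟩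

/-! ### Formal generalized eigenspaces -/

/-- `μ ↦ δ - μ` as a linear operator on power series. -/
def shift (D : VF n) (μ : ℂ) : Module.End ℂ (PS n) := (D : PS n →ₗ[ℂ] PS n) - μ • 1

theorem shift_apply (D : VF n) (μ : ℂ) (h : PS n) : shift D μ h = D h - μ • h := rfl

theorem shift_pow_succ_apply (D : VF n) (μ : ℂ) (N : ℕ) (h : PS n) :
    (shift D μ ^ (N + 1)) h = shift D μ ((shift D μ ^ N) h) := by
  rw [pow_succ']; rfl

theorem shift_pow_mem {D : VF n} (hD : D ∈ vanishing n) (μ : ℂ) (N : ℕ) {k : ℕ} {h : PS n}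
    (hh : h ∈ maximalIdeal (PS n) ^ k) : (shift D μ ^ N) h ∈ maximalIdeal (PS n) ^ k := by
  induction N with
  | zero => exact hh
  | succ N ih =>
    rw [shift_pow_succ_apply, shift_apply, smul_eq_C_mul]
    exact sub_mem (apply_mem_of_mem_vanishing hD ih) (Ideal.mul_mem_left _ _ ih)

theorem shift_pow_mem_of_le {D : VF n} (hD : D ∈ vanishing n) {μ : ℂ} {N M : ℕ} (hNM : N ≤ M)
    {k : ℕ} {h : PS n} (hh : (shift D μ ^ N) h ∈ maximalIdeal (PS n) ^ k) :
    (shift D μ ^ M) h ∈ maximalIdeal (PS n) ^ k := by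
  obtain ⟨d, rfl⟩ := Nat.exists_eq_add_of_le' hNM
  rw [pow_add]
  exact shift_pow_mem hD μ d hh

/-- The formal generalized eigenspace: power series on which `δ - μ` is topologically nilpotent. -/
def formalEigenspace (D : VF n) (μ : ℂ) : Submodule ℂ (PS n) where
  carrier := {h | ∀ k, ∃ N, ∀ M ≥ N, (shift D μ ^ M) h ∈ maximalIdeal (PS n) ^ k}
  zero_mem' k := ⟨0, fun M _ => by simp⟩
  add_mem' {a b} ha hb k := by
    obtain ⟨N₁, h₁⟩ := ha k
    obtain ⟨N₂, h₂⟩ := hb k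
    refine ⟨max N₁ N₂, fun M hM => ?_⟩
    rw [map_add]
    exact add_mem (h₁ M (le_trans (le_max_left _ _) hM)) (h₂ M (le_trans (le_max_right _ _) hM))
  smul_mem' c a ha k := by
    obtain ⟨N, h⟩ := ha k
    refine ⟨N, fun M hM => ?_⟩
    rw [map_smul, smul_eq_C_mul]
    exact Ideal.mul_mem_left _ _ (h M hM)

theorem mem_formalEigenspace_of_vanishing {D : VF n} (hD : D ∈ vanishing n) {μ : ℂ} {h : PS n}
    (hh : ∀ k, ∃ N, (shift D μ ^ N) h ∈ maximalIdeal (PS n) ^ k) : h ∈ formalEigenspace D μ :=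
  fun k => (hh k).imp fun _ hN _ hM => shift_pow_mem_of_le hD hM hN

theorem mem_formalEigenspace_of_closure {D : VF n} (hD : D ∈ vanishing n) {μ : ℂ} {h : PS n}
    (hh : ∀ k, ∃ h' ∈ formalEigenspace D μ, h - h' ∈ maximalIdeal (PS n) ^ k) :
    h ∈ formalEigenspace D μ := by
  refine mem_formalEigenspace_of_vanishing hD fun k => ?_
  obtain ⟨h', hh', hsub⟩ := hh k
  obtain ⟨N, hN⟩ := hh' k
  refine ⟨N, ?_⟩
  rw [← sub_add_cancel h h', map_add]
  exact add_mem (shift_pow_mem hD μ N hsub) (hN N le_rfl)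

/-- Iterated Leibniz rule for `(D - μ - ν)(ab) = (D - μ)a · b + a · (D - ν)b`. The binomial
coefficients play no role, so membership in the span suffices. -/
theorem shift_pow_mul_mem_span (D : VF n) (μ ν : ℂ) (a b : PS n) (M : ℕ) :
    (shift D (μ + ν) ^ M) (a * b) ∈ Submodule.span ℂ
      {x | ∃ i j, i + j = M ∧ x = (shift D μ ^ i) a * (shift D ν ^ j) b} := by
  induction M with
  | zero => exact Submodule.subset_span ⟨0, 0, rfl, rfl⟩
  | succ M ih =>
    rw [shift_pow_succ_apply]
    refine Submodule.span_induction
      (p := fun x _ => shift D (μ + ν) x ∈ Submodule.span ℂ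
        {x | ∃ i j, i + j = M + 1 ∧ x = (shift D μ ^ i) a * (shift D ν ^ j) b}) ?_ ?_ ?_ ?_ ih
    · rintro _ ⟨i, j, hij, rfl⟩
      have : shift D (μ + ν) ((shift D μ ^ i) a * (shift D ν ^ j) b) =
          (shift D μ ^ (i + 1)) a * (shift D ν ^ j) b +
          (shift D μ ^ i) a * (shift D ν ^ (j + 1)) b := by
        rw [shift_pow_succ_apply, shift_pow_succ_apply]
        simp only [shift_apply, Derivation.leibniz, smul_eq_mul, smul_eq_C_mul, map_add]
        ring
      rw [this]
      exact add_mem (Submodule.subset_span ⟨i + 1, j, by omega, rfl⟩)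
        (Submodule.subset_span ⟨i, j + 1, by omega, rfl⟩)
    · simp
    · intro x y _ _ hx hy
      rw [map_add]; exact add_mem hx hy
    · intro c x _ hx
      rw [map_smul]; exact Submodule.smul_mem _ _ hx

theorem mul_mem_formalEigenspace {D : VF n} {μ ν : ℂ} {a b : PS n}
    (ha : a ∈ formalEigenspace D μ) (hb : b ∈ formalEigenspace D ν) :
    a * b ∈ formalEigenspace D (μ + ν) := by
  intro k
  obtain ⟨N₁, h₁⟩ := ha k
  obtain ⟨N₂, h₂⟩ := hb k
  refine ⟨N₁ + N₂, fun M hM => ?_⟩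
  have hle : Submodule.span ℂ {x | ∃ i j, i + j = M ∧ x = (shift D μ ^ i) a * (shift D ν ^ j) b} ≤
      (maximalIdeal (PS n) ^ k).restrictScalars ℂ := by
    rw [Submodule.span_le]
    rintro _ ⟨i, j, hij, rfl⟩
    rcases le_or_gt N₁ i with h | h
    · exact Ideal.mul_mem_right _ _ (h₁ i h)
    · exact Ideal.mul_mem_left _ _ (h₂ j (by omega))
  exact hle (shift_pow_mul_mem_span D μ ν a b M)

theorem C_mem_formalEigenspace (D : VF n) (c : ℂ) : C c ∈ formalEigenspace D 0 := by
  intro k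
  refine ⟨1, fun M hM => ?_⟩
  obtain ⟨M, rfl⟩ := Nat.exists_eq_add_of_le' hM
  have : shift D 0 (C c) = 0 := by
    rw [shift_apply, zero_smul, sub_zero]
    exact D.map_algebraMap c
  rw [pow_succ]
  change (shift D 0 ^ M) (shift D 0 (C c)) ∈ _
  rw [this, map_zero]
  exact zero_mem _

theorem pow_mem_formalEigenspace {D : VF n} {μ : ℂ} {a : PS n} (ha : a ∈ formalEigenspace D μ)
    (m : ℕ) : a ^ m ∈ formalEigenspace D (m * μ) := by
  induction m with
  | zero => simpa using C_mem_formalEigenspace D 1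
  | succ m ih =>
    rw [pow_succ]
    convert mul_mem_formalEigenspace ih ha using 2
    push_cast; ring

theorem prod_mem_formalEigenspace {D : VF n} {ι : Type*} (s : Finset ι) {μ : ι → ℂ}
    {a : ι → PS n} (ha : ∀ i, a i ∈ formalEigenspace D (μ i)) :
    ∏ i ∈ s, a i ∈ formalEigenspace D (∑ i ∈ s, μ i) := by
  classical
  induction s using Finset.induction_on with
  | empty => simpa using C_mem_formalEigenspace D 1
  | insert i s his ih =>
    rw [Finset.prod_insert his, Finset.sum_insert his]
    exact mul_mem_formalEigenspace (ha i) ih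

instance finite_quotient_pow (n k : ℕ) : Module.Finite ℂ
    (PS n ⧸ (maximalIdeal (PS n) ^ k).restrictScalars ℂ) := by
  have hfin : Finite {α : Fin n →₀ ℕ // α.degree < k} :=
    (Finsupp.finite_of_degree_lt (σ := Fin n) k).to_subtype
  let L : PS n →ₗ[ℂ] ({α : Fin n →₀ ℕ // α.degree < k} → ℂ) :=
    LinearMap.pi fun α => coeff α.1
  have hker : (maximalIdeal (PS n) ^ k).restrictScalars ℂ = LinearMap.ker L := by
    ext h
    rw [Submodule.restrictScalars_mem, mem_pow_iff, LinearMap.mem_ker, funext_iff, Subtype.forall]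
    rfl
  rw [hker]
  exact Module.Finite.of_injective _ (LinearMap.ker_eq_bot.1 (Submodule.ker_liftQ_eq_bot' _ L rfl))

/-- Fitting's lemma on an invariant subspace. -/
theorem exists_pow_sub_pow_eq_zero {V : Type*} [AddCommGroup V] [Module ℂ V] [Module.Finite ℂ V]
    (U : Module.End ℂ V) {W : Submodule ℂ V} (hW : ∀ x ∈ W, U x ∈ W) (N : ℕ) {x : V}
    (hx : x ∈ W) : ∃ b ∈ W, ∃ M, (U ^ M) (x - (U ^ N) b) = 0 := by
  have hpow : ∀ (m : ℕ) (w : W), (((U.restrict hW) ^ m) w : V) = (U ^ m) w := by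
    intro m w
    induction m with
    | zero => rfl
    | succ m ih => rw [pow_succ', pow_succ']; simp [ih]
  obtain ⟨m₀, hm₀⟩ := Filter.eventually_atTop.1
    (LinearMap.eventually_isCompl_ker_pow_range_pow (U.restrict hW))
  have hm := hm₀ (m₀ + N) (by omega)
  obtain ⟨a, ha, c, hc, hac⟩ := Submodule.mem_sup.1
    (hm.sup_eq_top ▸ Submodule.mem_top : (⟨x, hx⟩ : W) ∈ _)
  obtain ⟨b, rfl⟩ := hc
  -- The range part of `x` is `U ^ (m₀ + N)` applied to `b`. Absorbing `U ^ m₀` into the witness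
  -- leaves `U ^ N` outside, and the remaining part of `x` lies in the kernel of `U ^ (m₀ + N)`.
  refine ⟨(U ^ m₀) b, ?_, m₀ + N, ?_⟩
  · rw [← hpow]; exact Subtype.property _
  · have h1 : x - (U ^ N) ((U ^ m₀) b) = a := by
      have := congrArg Subtype.val hac
      rw [Submodule.coe_add, hpow, add_comm m₀ N, pow_add] at this
      rw [sub_eq_iff_eq_add]
      exact this.symm
    rw [h1, ← hpow, LinearMap.mem_ker.1 ha]
    rfl

/-- Modulo `𝔪 ^ (k + 1)`, the obstruction `(D - μ) ^ N h` lies in the invariant subspace `𝔪 ^ k / 𝔪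
^ (k + 1)`. By Fitting's lemma there, subtracting `(D - μ) ^ N b` with `b ∈ 𝔪 ^ k` makes it
nilpotent under `D - μ`; the corrected series is `h - b`. -/
theorem exists_lift_step {D : VF n} (hD : D ∈ vanishing n) (μ : ℂ) {k N : ℕ} {h : PS n}
    (hh : (shift D μ ^ N) h ∈ maximalIdeal (PS n) ^ k) :
    ∃ h', h' - h ∈ maximalIdeal (PS n) ^ k ∧
      ∃ M, (shift D μ ^ M) h' ∈ maximalIdeal (PS n) ^ (k + 1) := by
  let I : Submodule ℂ (PS n) := (maximalIdeal (PS n) ^ (k + 1)).restrictScalars ℂ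
  let P : Submodule ℂ (PS n) := (maximalIdeal (PS n) ^ k).restrictScalars ℂ
  have hI : I ≤ I.comap (shift D μ) := fun x hx => shift_pow_mem hD μ 1 hx
  let U : Module.End ℂ (PS n ⧸ I) := I.mapQ I (shift D μ) hI
  have hU : ∀ (m : ℕ) (x : PS n), (U ^ m) (I.mkQ x) = I.mkQ ((shift D μ ^ m) x) := by
    intro m x
    induction m with
    | zero => rfl
    | succ m ih => rw [pow_succ', pow_succ', Module.End.mul_apply, ih]; rfl
  have hW : ∀ x ∈ P.map I.mkQ, U x ∈ P.map I.mkQ := by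
    rintro _ ⟨x, hx, rfl⟩
    exact ⟨shift D μ x, shift_pow_mem hD μ 1 hx, rfl⟩
  obtain ⟨_, ⟨b, hb, rfl⟩, M, hM⟩ := exists_pow_sub_pow_eq_zero U hW N
    (Submodule.mem_map_of_mem (f := I.mkQ) (p := P) hh)
  refine ⟨h - b, ?_, M + N, ?_⟩
  · rw [sub_sub_cancel_left]; exact neg_mem hb
  · rw [hU, ← map_sub, hU, Submodule.mkQ_apply, Submodule.Quotient.mk_eq_zero, ← map_sub] at hM
    rw [pow_add (shift D μ)]
    exact hM

/-- The corrections of `exists_lift_step` have increasing order, so by completeness they converge to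
a genuine element of the formal eigenspace. -/
theorem exists_mem_formalEigenspace_sub_mem {D : VF n} (hD : D ∈ vanishing n) (μ : ℂ) {k N : ℕ}
    {h : PS n} (hh : (shift D μ ^ N) h ∈ maximalIdeal (PS n) ^ k) :
    ∃ y ∈ formalEigenspace D μ, y - h ∈ maximalIdeal (PS n) ^ k := by
  let S (m : ℕ) := {x : PS n // ∃ M, (shift D μ ^ M) x ∈ maximalIdeal (PS n) ^ (k + m)}
  have step : ∀ m (x : S m), ∃ y : S (m + 1), y.1 - x.1 ∈ maximalIdeal (PS n) ^ (k + m) := by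
    rintro m ⟨x, M, hx⟩
    obtain ⟨y, hy, hM⟩ := exists_lift_step hD μ hx
    exact ⟨⟨y, hM⟩, hy⟩
  choose next hnext using step
  let seq : ∀ m, S m := fun m => Nat.rec ⟨h, N, hh⟩ next m
  have hseq : ∀ m, (seq (m + 1)).1 - (seq m).1 ∈ maximalIdeal (PS n) ^ (k + m) :=
    fun m => hnext m (seq m)
  have hcauchy : ∀ a b, a ≤ b → (seq b).1 - (seq a).1 ∈ maximalIdeal (PS n) ^ (k + a) := by
    intro a b hab
    induction b, hab using Nat.le_induction with
    | base => simp
    | succ b hab ih =>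
      rw [← sub_add_sub_cancel _ (seq b).1]
      exact add_mem (Ideal.pow_le_pow_right (by omega) (hseq b)) ih
  obtain ⟨y, hy⟩ := IsPrecomplete.prec (I := maximalIdeal (PS n)) inferInstance
    (f := fun m => (seq m).1) (fun {a b} hab => by
      rw [SModEq.comm, SModEq.sub_mem, smul_eq_mul, Ideal.mul_top]
      exact Ideal.pow_le_pow_right (by omega) (hcauchy a b hab))
  have hy' : ∀ m, y - (seq m).1 ∈ maximalIdeal (PS n) ^ m := by
    intro m
    have := (hy m).symm
    rwa [SModEq.sub_mem, smul_eq_mul, Ideal.mul_top] at this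
  refine ⟨y, mem_formalEigenspace_of_vanishing hD fun m => ?_, ?_⟩
  · obtain ⟨M, hM⟩ := (seq m).2
    refine ⟨M, ?_⟩
    rw [← sub_add_cancel y (seq m).1, map_add]
    exact add_mem (shift_pow_mem hD μ M (hy' m)) (Ideal.pow_le_pow_right (by omega) hM)
  · rw [← sub_add_sub_cancel y (seq k).1]
    exact add_mem (hy' k) (hcauchy 0 k (Nat.zero_le k))

theorem linCoeff_shift_pow {D : VF n} (hD : D ∈ vanishing n) (μ : ℂ) (N : ℕ) (h : PS n) :
    linCoeff n ((shift D μ ^ N) h) =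
      ((Matrix.toLin' (linearMatrix D) - μ • 1) ^ N) (linCoeff n h) := by
  induction N with
  | zero => rfl
  | succ N ih =>
    rw [shift_pow_succ_apply, shift_apply, map_sub, linCoeff_derivation hD, map_smul, ih, pow_succ']
    simp

/-- The linear form with coefficients `v` is a generalized eigenvector modulo `𝔪²`, and lifting it
changes only terms in `𝔪²`. -/
theorem exists_mem_formalEigenspace_linCoeff {D : VF n} (hD : D ∈ vanishing n) {μ : ℂ}
    {v : Fin n → ℂ} (hv : v ∈ Module.End.maxGenEigenspace (Matrix.toLin' (linearMatrix D)) μ) :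
    ∃ y ∈ formalEigenspace D μ, y ∈ maximalIdeal (PS n) ∧ linCoeff n y = v := by
  obtain ⟨N, hN⟩ := (Module.End.mem_maxGenEigenspace _ _ _).1 hv
  let h : PS n := ∑ i, v i • X i
  have hm : h ∈ maximalIdeal (PS n) := sum_mem fun i _ => by
    rw [smul_eq_C_mul]
    exact Ideal.mul_mem_left _ _ (X_mem_maximalIdeal i)
  have hlin : linCoeff n h = v := by
    simp only [h, map_sum, map_smul, linCoeff_X]
    ext i
    simp [Pi.single_apply]
  have h2 : (shift D μ ^ N) h ∈ maximalIdeal (PS n) ^ 2 := by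
    rw [mem_sq_iff, linCoeff_shift_pow hD, hlin, hN]
    simpa using shift_pow_mem hD μ N (k := 1) (by simpa using hm)
  obtain ⟨y, hy, hyh⟩ := exists_mem_formalEigenspace_sub_mem hD μ h2
  have hyh1 : y - h ∈ maximalIdeal (PS n) := Ideal.pow_le_self two_ne_zero hyh
  refine ⟨y, hy, by simpa using add_mem hyh1 hm, ?_⟩
  rw [mem_sq_iff hyh1, map_sub, hlin, sub_eq_zero] at hyh
  exact hyh

theorem linCoeff_mem_maxGenEigenspace {D : VF n} (hD : D ∈ vanishing n) {μ : ℂ} {y : PS n}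
    (hy : y ∈ formalEigenspace D μ) (hm : y ∈ maximalIdeal (PS n)) :
    linCoeff n y ∈ Module.End.maxGenEigenspace (Matrix.toLin' (linearMatrix D)) μ := by
  obtain ⟨N, hN⟩ := hy 2
  refine (Module.End.mem_maxGenEigenspace _ _ _).2 ⟨N, ?_⟩
  have h1 : (shift D μ ^ N) y ∈ maximalIdeal (PS n) := by
    simpa using shift_pow_mem hD μ N (k := 1) (by simpa using hm)
  rw [← linCoeff_shift_pow hD, (mem_sq_iff h1).1 (hN N le_rfl)]

/-- Since `J` contains a power of `𝔪`, topological nilpotence becomes nilpotence in the quotient by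
`J`, where generalized eigenspaces of the induced operator are independent. -/
theorem mem_of_sum_mem_of_mem_formalEigenspace {D : VF n} {J : Submodule ℂ (PS n)}
    (hJ : ∀ x ∈ J, D x ∈ J) {k : ℕ} (hk : ∀ x ∈ maximalIdeal (PS n) ^ k, x ∈ J) {F : Finset ℂ}
    {h : ℂ → PS n} (hh : ∀ c ∈ F, h c ∈ formalEigenspace D c) (hsum : ∑ c ∈ F, h c ∈ J) :
    ∀ c ∈ F, h c ∈ J := by
  have hJ' : J ≤ J.comap (D : PS n →ₗ[ℂ] PS n) := hJ
  let U : Module.End ℂ (PS n ⧸ J) := J.mapQ J (D : PS n →ₗ[ℂ] PS n) hJ'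
  have hU : ∀ (c : ℂ) (m : ℕ) (x : PS n),
      ((U - c • 1) ^ m) (J.mkQ x) = J.mkQ ((shift D c ^ m) x) := by
    intro c m x
    induction m with
    | zero => rfl
    | succ m ih => rw [pow_succ', pow_succ', Module.End.mul_apply, ih]; rfl
  have hmem : ∀ c ∈ F, J.mkQ (h c) ∈ U.maxGenEigenspace c := by
    intro c hc
    obtain ⟨N, hN⟩ := hh c hc k
    refine (Module.End.mem_maxGenEigenspace _ _ _).2 ⟨N, ?_⟩
    rw [hU, Submodule.mkQ_apply, Submodule.Quotient.mk_eq_zero]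
    exact hk _ (hN N le_rfl)
  have hind := (iSupIndep_iff_finsetSum_eq_zero_imp_eq_zero _).1 U.independent_maxGenEigenspace
  intro c hc
  rw [← Submodule.Quotient.mk_eq_zero, ← Submodule.mkQ_apply]
  refine hind F (fun c => J.mkQ (h c)) hmem ?_ c hc
  rw [← map_sum, Submodule.mkQ_apply, Submodule.Quotient.mk_eq_zero]
  exact hsum

theorem mem_formalEigenspace_of_apply_eq_smul {D : VF n} {c : ℂ} {h : PS n} (hh : D h = c • h) :
    h ∈ formalEigenspace D c := by
  intro k
  refine ⟨1, fun M hM => ?_⟩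
  obtain ⟨M, rfl⟩ := Nat.exists_eq_add_of_le' hM
  rw [pow_succ, Module.End.mul_apply, shift_apply, hh, sub_self, map_zero]
  exact zero_mem _

/-! ### Coordinate changes and the formal inverse function theorem -/

/-- Algebra maps are automatically local: if `φ h` had constant term `c ≠ 0`, then `h - c` would be
a unit while its image has constant term zero. -/
theorem algHom_mem_maximalIdeal {m : ℕ} (φ : PS n →ₐ[ℂ] PS m) {h : PS n}
    (hh : h ∈ maximalIdeal (PS n)) : φ h ∈ maximalIdeal (PS m) := by
  rw [mem_maximalIdeal_iff]
  by_contra hc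
  have h1 : IsUnit (h - C (constantCoeff (φ h))) := by
    rw [MvPowerSeries.isUnit_iff_constantCoeff, map_sub, mem_maximalIdeal_iff.1 hh,
      constantCoeff_C, zero_sub]
    exact (neg_ne_zero.2 hc).isUnit
  have h2 := h1.map φ
  rw [MvPowerSeries.isUnit_iff_constantCoeff, map_sub] at h2
  have h3 : φ (C (constantCoeff (φ h))) = C (constantCoeff (φ h)) := φ.commutes _
  rw [h3, map_sub, constantCoeff_C, sub_self] at h2
  exact not_isUnit_zero h2

theorem algHom_mem_pow {m : ℕ} (φ : PS n →ₐ[ℂ] PS m) {k : ℕ} {h : PS n}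
    (hh : h ∈ maximalIdeal (PS n) ^ k) : φ h ∈ maximalIdeal (PS m) ^ k := by
  have h1 : (maximalIdeal (PS n)).map φ ≤ maximalIdeal (PS m) :=
    Ideal.map_le_iff_le_comap.2 fun x hx => algHom_mem_maximalIdeal φ hx
  have h2 := Ideal.mem_map_of_mem φ hh
  rw [Ideal.map_pow] at h2
  exact Ideal.pow_right_mono h1 k h2

theorem algHom_coe_polynomial {m : ℕ} (φ : PS n →ₐ[ℂ] PS m) (p : MvPolynomial (Fin n) ℂ) :
    φ (p : PS n) = MvPolynomial.aeval (fun i => φ (X i)) p := by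
  induction p using MvPolynomial.induction_on with
  | C a => rw [MvPolynomial.coe_C, MvPolynomial.aeval_C]; exact φ.commutes a
  | add p q hp hq => rw [MvPolynomial.coe_add, map_add, hp, hq, map_add]
  | mul_X p i hp =>
    rw [MvPolynomial.coe_mul, map_mul, hp, MvPolynomial.coe_X, map_mul, MvPolynomial.aeval_X]

theorem algHom_ext_X {m : ℕ} {φ ψ : PS n →ₐ[ℂ] PS m} (h : ∀ i, φ (X i) = ψ (X i)) : φ = ψ := by
  ext1 x
  rw [← sub_eq_zero]
  refine eq_zero_of_forall_mem_pow fun k => ?_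
  have h1 : φ x - ψ x = φ (x - (truncTotal k x : MvPolynomial (Fin n) ℂ)) -
      ψ (x - (truncTotal k x : MvPolynomial (Fin n) ℂ)) := by
    rw [map_sub, map_sub, algHom_coe_polynomial φ, algHom_coe_polynomial ψ, funext h]
    ring
  rw [h1]
  exact sub_mem (algHom_mem_pow φ (sub_truncTotal_mem k x))
    (algHom_mem_pow ψ (sub_truncTotal_mem k x))

/-- The endomorphism `xᵢ ↦ yᵢ`. -/
def coordHom (y : Fin n → PS n) (hy : ∀ i, y i ∈ maximalIdeal (PS n)) : PS n →ₐ[ℂ] PS n :=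
  substAlgHom (hasSubst_of_constantCoeff_zero fun i => mem_maximalIdeal_iff.1 (hy i))

theorem coordHom_X (y : Fin n → PS n) (hy : ∀ i, y i ∈ maximalIdeal (PS n)) (i : Fin n) :
    coordHom y hy (X i) = y i := substAlgHom_X _ i

/-- For `θ` tangent to the identity, `θ - id` raises the `𝔪`-adic order. This gives injectivity, and
convergence of the iteration that proves surjectivity. -/
theorem algHom_sub_mem {θ : PS n →ₐ[ℂ] PS n} (hθ : ∀ i, θ (X i) - X i ∈ maximalIdeal (PS n) ^ 2)
    {k : ℕ} {h : PS n} (hh : h ∈ maximalIdeal (PS n) ^ k) :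
    θ h - h ∈ maximalIdeal (PS n) ^ (k + 1) := by
  have h0 : ∀ h, θ h - h ∈ maximalIdeal (PS n) := by
    intro h
    have h1 : θ h - h = θ (h - C (constantCoeff h)) - (h - C (constantCoeff h)) := by
      rw [map_sub, show θ (C (constantCoeff h)) = C (constantCoeff h) from θ.commutes _]
      ring
    have h2 : h - C (constantCoeff h) ∈ maximalIdeal (PS n) := by
      rw [mem_maximalIdeal_iff]; simp
    rw [h1]
    exact sub_mem (algHom_mem_maximalIdeal θ h2) h2
  have h1 : ∀ h ∈ maximalIdeal (PS n), θ h - h ∈ maximalIdeal (PS n) ^ 2 := by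
    intro h hh
    rw [← span_range_X] at hh
    refine Submodule.span_induction ?_ (by simp) ?_ ?_ hh
    · rintro _ ⟨i, rfl⟩
      exact hθ i
    · intro x y _ _ hx hy
      rw [map_add, add_sub_add_comm]
      exact add_mem hx hy
    · intro a x hx hx'
      replace hx : x ∈ maximalIdeal (PS n) := span_range_X.le hx
      have : θ (a • x) - a • x = θ a * (θ x - x) + (θ a - a) * x := by
        rw [smul_eq_mul, map_mul]; ring
      rw [this]
      refine add_mem (Ideal.mul_mem_left _ _ hx') ?_
      rw [pow_two]
      exact Ideal.mul_mem_mul (h0 a) hx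
  induction k generalizing h with
  | zero => simpa using h0 h
  | succ k ih =>
    rw [pow_succ'] at hh
    refine Submodule.mul_induction_on hh (fun a ha b hb => ?_) (fun a b ha hb => ?_)
    · have : θ (a * b) - a * b = (θ a - a) * θ b + a * (θ b - b) := by
        rw [map_mul]; ring
      rw [this]
      refine add_mem ?_ ?_
      · rw [show k + 1 + 1 = 2 + k by ring, pow_add]
        exact Ideal.mul_mem_mul (h1 a ha) (algHom_mem_pow θ hb)
      · rw [pow_succ' _ (k + 1)]
        exact Ideal.mul_mem_mul ha (ih hb)
    · rw [map_add, add_sub_add_comm]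
      exact add_mem ha hb

theorem algHom_bijective_of_sub_mem_sq {θ : PS n →ₐ[ℂ] PS n}
    (hθ : ∀ i, θ (X i) - X i ∈ maximalIdeal (PS n) ^ 2) : Function.Bijective θ := by
  constructor
  · rw [injective_iff_map_eq_zero]
    intro h hh
    refine eq_zero_of_forall_mem_pow fun k => ?_
    induction k with
    | zero => simp
    | succ k ih =>
      have := algHom_sub_mem hθ ih
      rwa [hh, zero_sub, neg_mem_iff] at this
  · intro h
    -- Picard iteration for `θ y = h`: the defect `h - θ (x m)` gains one order at each step.
    let x : ℕ → PS n := fun m => Nat.rec 0 (fun _ y => y + (h - θ y)) m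
    have hx : ∀ m, x (m + 1) = x m + (h - θ (x m)) := fun m => rfl
    have hmem : ∀ m, h - θ (x m) ∈ maximalIdeal (PS n) ^ m := by
      intro m
      induction m with
      | zero => simp
      | succ m ih =>
        rw [hx, map_add, ← sub_sub, ← neg_sub (θ _) (h - θ (x m)), neg_mem_iff]
        exact algHom_sub_mem hθ ih
    have hcauchy : ∀ a b, a ≤ b → x b - x a ∈ maximalIdeal (PS n) ^ a := by
      intro a b hab
      induction b, hab using Nat.le_induction with
      | base => simp
      | succ b hab ih =>
        rw [hx, add_sub_right_comm]
        exact add_mem ih (Ideal.pow_le_pow_right hab (hmem b))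
    obtain ⟨y, hy⟩ := IsPrecomplete.prec (I := maximalIdeal (PS n)) inferInstance
      (f := x) (fun {a b} hab => by
        rw [SModEq.comm, SModEq.sub_mem, smul_eq_mul, Ideal.mul_top]
        exact hcauchy a b hab)
    refine ⟨y, ?_⟩
    rw [← sub_eq_zero]
    refine eq_zero_of_forall_mem_pow fun m => ?_
    have h1 := (hy m).symm
    rw [SModEq.sub_mem, smul_eq_mul, Ideal.mul_top] at h1
    have h2 : θ y - h = θ (y - x m) - (h - θ (x m)) := by rw [map_sub]; ring
    rw [h2]
    exact sub_mem (algHom_mem_pow θ h1) (hmem m)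

/-- The linear substitution `xⱼ ↦ ∑ᵢ Qᵢⱼ xᵢ`. -/
def linearHom (Q : Matrix (Fin n) (Fin n) ℂ) : PS n →ₐ[ℂ] PS n :=
  coordHom (fun j => ∑ i, Q i j • X i) fun _ => sum_mem fun i _ => by
    rw [smul_eq_C_mul]
    exact Ideal.mul_mem_left _ _ (X_mem_maximalIdeal i)

theorem linearHom_X (Q : Matrix (Fin n) (Fin n) ℂ) (j : Fin n) :
    linearHom Q (X j) = ∑ i, Q i j • X i := coordHom_X _ _ j

theorem linearHom_comp (P Q : Matrix (Fin n) (Fin n) ℂ) :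
    (linearHom P).comp (linearHom Q) = linearHom (P * Q) := by
  refine algHom_ext_X fun j => ?_
  rw [AlgHom.comp_apply, linearHom_X, linearHom_X, map_sum]
  simp only [map_smul, linearHom_X, Finset.smul_sum, Matrix.mul_apply, Finset.sum_smul, smul_smul]
  rw [Finset.sum_comm]
  simp only [mul_comm]

theorem linearHom_one : linearHom (1 : Matrix (Fin n) (Fin n) ℂ) = AlgHom.id ℂ (PS n) := by
  refine algHom_ext_X fun j => ?_
  rw [linearHom_X, Finset.sum_eq_single j]
  · simp
  · intro i _ hij
    simp [hij]
  · simp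

/-- Formal inverse function theorem. -/
theorem coordHom_bijective (y : Fin n → PS n) (hy : ∀ i, y i ∈ maximalIdeal (PS n))
    (hlin : LinearIndependent ℂ fun i => linCoeff n (y i)) :
    Function.Bijective (coordHom y hy) := by
  let P : Matrix (Fin n) (Fin n) ℂ := Matrix.of fun i j => linCoeff n (y j) i
  have hP : IsUnit P := Matrix.linearIndependent_cols_iff_isUnit.1 hlin
  obtain ⟨Q, hPQ, hQP⟩ := isUnit_iff_exists.1 hP
  -- Composing with the inverse of the linear part gives a map tangent to the identity.
  have hbij : Function.Bijective ((coordHom y hy).comp (linearHom Q)) := by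
    refine algHom_bijective_of_sub_mem_sq fun j => ?_
    have hm : ((coordHom y hy).comp (linearHom Q)) (X j) - X j ∈ maximalIdeal (PS n) :=
      sub_mem (algHom_mem_maximalIdeal _ (X_mem_maximalIdeal j)) (X_mem_maximalIdeal j)
    rw [mem_sq_iff hm, map_sub, sub_eq_zero, AlgHom.comp_apply, linearHom_X, map_sum, map_sum,
      linCoeff_X]
    simp only [map_smul, coordHom_X]
    ext i
    have := congrFun (congrFun hPQ i) j
    rw [Matrix.mul_apply, Matrix.one_apply] at this
    rw [Finset.sum_apply, Pi.single_apply, ← this]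
    exact Finset.sum_congr rfl fun k _ => mul_comm _ _
  have hcomp : coordHom y hy = ((coordHom y hy).comp (linearHom Q)).comp (linearHom P) := by
    rw [AlgHom.comp_assoc, linearHom_comp, hQP, linearHom_one, AlgHom.comp_id]
  have hPbij : Function.Bijective (linearHom P) := by
    refine Function.bijective_iff_has_inverse.2 ⟨linearHom Q, fun x => ?_, fun x => ?_⟩
    · rw [← AlgHom.comp_apply, linearHom_comp, hQP, linearHom_one]; rfl
    · rw [← AlgHom.comp_apply, linearHom_comp, hPQ, linearHom_one]; rfl
  rw [hcomp]
  exact hbij.comp hPbij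

/-- The coordinate change `xᵢ ↦ yᵢ`. -/
def coordEquiv (y : Fin n → PS n) (hy : ∀ i, y i ∈ maximalIdeal (PS n))
    (hlin : LinearIndependent ℂ fun i => linCoeff n (y i)) : PS n ≃ₐ[ℂ] PS n :=
  AlgEquiv.ofBijective (coordHom y hy) (coordHom_bijective y hy hlin)

theorem coordEquiv_X (y : Fin n → PS n) (hy : ∀ i, y i ∈ maximalIdeal (PS n))
    (hlin : LinearIndependent ℂ fun i => linCoeff n (y i)) (i : Fin n) :
    coordEquiv y hy hlin (X i) = y i := coordHom_X y hy i

/-! ### Unique factorization via Weierstrass preparation -/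

theorem exists_monic_of_isUnit_leadingCoeff {A : Type*} [CommRing A] {q : Polynomial A}
    (h : IsUnit q.leadingCoeff) : ∃ p : Polynomial A, p.Monic ∧ Associated p q := by
  obtain ⟨u, hu⟩ := h
  have hmon : (Polynomial.C (↑u⁻¹ : A) * q).Monic :=
    Polynomial.monic_C_mul_of_mul_leadingCoeff_eq_one (by rw [← hu, Units.inv_mul])
  refine ⟨_, hmon, Associated.symm ⟨Units.map (Polynomial.C : A →+* _).toMonoidHom u⁻¹, ?_⟩⟩
  simp [mul_comm]

/-- A monic divisor of a distinguished polynomial is distinguished. -/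
theorem isDistinguishedAt_of_dvd {A : Type*} [CommRing A] [IsLocalRing A] {p w : Polynomial A}
    (hp : p.Monic) (hw : w.IsDistinguishedAt (maximalIdeal A)) (hpw : p ∣ w) :
    p.IsDistinguishedAt (maximalIdeal A) := by
  -- Over the residue field `w` becomes a power of `X`, whose monic divisors are again powers of
  -- `X`.
  have h1 : p.map (residue A) ∣ Polynomial.X ^ w.natDegree := by
    have := Polynomial.map_dvd (residue A) hpw
    rwa [show w.map (residue A) = _ from hw.map_eq_X_pow] at this
  obtain ⟨d, -, hd⟩ := (dvd_prime_pow Polynomial.prime_X _).1 h1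
  have h2 : p.map (residue A) = Polynomial.X ^ d :=
    Polynomial.eq_of_monic_of_associated (hp.map _) (Polynomial.monic_X_pow d) hd
  have hdeg : p.natDegree = d := by
    rw [← hp.natDegree_map (residue A), h2, Polynomial.natDegree_X_pow]
  refine ⟨⟨fun {i} hi => ?_⟩, hp⟩
  have := congrArg (fun q => Polynomial.coeff q i) h2
  rw [Polynomial.coeff_map, Polynomial.coeff_X_pow, if_neg (by omega)] at this
  exact (residue_eq_zero_iff _).1 this

/-- A prime polynomial that is distinguished stays prime in the ring of power series. -/
theorem prime_coe_of_isDistinguishedAt {A : Type*} [CommRing A] [IsDomain A] [IsLocalRing A]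
    [IsAdicComplete (maximalIdeal A) A] {p : Polynomial A} (hp : Prime p)
    (hd : p.IsDistinguishedAt (maximalIdeal A)) : Prime (p : PowerSeries A) := by
  have h0 : (p : PowerSeries A) ≠ 0 := by
    rw [Ne, Polynomial.coe_eq_zero_iff]; exact hp.ne_zero
  rw [← Ideal.span_singleton_prime h0, ← Ideal.Quotient.isDomain_iff_prime]
  have : (Ideal.span {p}).IsPrime := (Ideal.span_singleton_prime hp.ne_zero).2 hp
  -- Weierstrass division identifies the quotients of the polynomial and the power series ring by
  -- `p`.
  exact hd.algEquivQuotient.symm.toMulEquiv.isDomain _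

/-- Prime ideals containing a power series with nonzero reduction contain a prime element. -/
theorem exists_prime_mem_of_map_ne_zero {A : Type*} [CommRing A] [IsDomain A] [IsLocalRing A]
    [IsAdicComplete (maximalIdeal A) A] [UniqueFactorizationMonoid A]
    {P : Ideal (PowerSeries A)} [hP : P.IsPrime] {g : PowerSeries A} (hgP : g ∈ P)
    (hg : g.map (residue A) ≠ 0) : ∃ x ∈ P, Prime x := by
  -- Write `g` as a distinguished polynomial `w` times a unit. Then `w` lies in `P`, and so does one
  -- of its prime factors in the factorial ring `A[X]`.
  obtain ⟨w, h, H⟩ := PowerSeries.exists_isWeierstrassFactorization hg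
  let 𝔭 : Ideal (Polynomial A) := P.comap (Polynomial.coeToPowerSeries.ringHom (R := A))
  have hw : w ∈ 𝔭 := by
    have := H.eq_mul ▸ hgP
    exact (hP.mem_or_mem this).resolve_right
      fun hh => hP.ne_top (Ideal.eq_top_of_isUnit_mem _ hh H.isUnit)
  have hw0 : w ≠ 0 := H.isDistinguishedAt.monic.ne_zero
  obtain ⟨s, hs, u, hu⟩ := UniqueFactorizationMonoid.exists_prime_factors w hw0
  have hs𝔭 : s.prod ∈ 𝔭 := by
    have h1 : s.prod * u ∈ 𝔭 := hu ▸ hw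
    exact (Ideal.IsPrime.mem_or_mem (Ideal.IsPrime.comap _) h1).resolve_right
      fun hh => (Ideal.IsPrime.comap _ : 𝔭.IsPrime).ne_top (Ideal.eq_top_of_isUnit_mem _ hh u.isUnit)
  have h𝔭 : 𝔭.IsPrime := Ideal.IsPrime.comap _
  obtain ⟨q, hqs, hq⟩ := (Ideal.IsPrime.multiset_prod_mem_iff_exists_mem h𝔭 s).1 hs𝔭
  have hqw : q ∣ w := (Multiset.dvd_prod hqs).trans (Dvd.intro _ hu)
  have hlead : IsUnit q.leadingCoeff := by
    obtain ⟨r, rfl⟩ := hqw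
    have := H.isDistinguishedAt.monic
    rw [Polynomial.Monic, Polynomial.leadingCoeff_mul] at this
    exact IsUnit.of_mul_eq_one _ this
  obtain ⟨p, hpm, hpq⟩ := exists_monic_of_isUnit_leadingCoeff hlead
  have hp : Prime p := hpq.symm.prime (hs q hqs)
  refine ⟨p, ?_, prime_coe_of_isDistinguishedAt hp
    (isDistinguishedAt_of_dvd hpm H.isDistinguishedAt (hpq.dvd.trans hqw))⟩
  have : p ∈ 𝔭 := by
    obtain ⟨v, hv⟩ := hpq.symm
    rw [← hv]
    exact Ideal.mul_mem_right _ _ hq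
  exact this

/-- Restriction of power series to the line spanned by the first coordinate. -/
def restrictLine (n : ℕ) : PS (n + 1) →+* PowerSeries ℂ :=
  (PowerSeries.map (constantCoeff (σ := Fin n) (R := ℂ))).comp
    (finSuccEquiv ℂ n : PS (n + 1) →+* PowerSeries (PS n))

theorem coeff_restrictLine (h : PS (n + 1)) (k : ℕ) :
    PowerSeries.coeff k (restrictLine n h) = coeff (Finsupp.single 0 k) h := by
  have := coeff_coeff_finSuccEquiv (R := ℂ) h (k := k) (x := 0)
  rw [coeff_zero_eq_constantCoeff_apply] at this
  rw [← Finsupp.cons_eq_single_zero_iff.2 ⟨rfl, rfl⟩, ← this]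
  rfl

/-- Pick a direction `a` on which the initial form of `f` does not vanish and turn the first axis
into it. The restriction then has order exactly the order `N` of `f`. -/
theorem exists_coordinates_regular {f : PS (n + 1)} (hf : f ≠ 0) :
    ∃ φ : PS (n + 1) ≃ₐ[ℂ] PS (n + 1), restrictLine n (φ f) ≠ 0 := by
  have hex : ∃ N, ∃ α : Fin (n + 1) →₀ ℕ, α.degree = N ∧ coeff α f ≠ 0 := by
    by_contra hc
    push Not at hc
    exact hf (MvPowerSeries.ext fun α => hc _ α rfl)
  classical
  let N := Nat.find hex
  obtain ⟨α₀, hα₀, hα₀'⟩ : ∃ α : Fin (n + 1) →₀ ℕ, α.degree = N ∧ coeff α f ≠ 0 :=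
    Nat.find_spec hex
  have hmin : ∀ α : Fin (n + 1) →₀ ℕ, α.degree < N → coeff α f = 0 := by
    intro α hα
    by_contra hc
    exact Nat.find_min hex hα ⟨α, rfl, hc⟩
  let p : MvPolynomial (Fin (n + 1)) ℂ := truncTotal (N + 1) f
  have hp : p ≠ 0 := by
    intro h
    have := congrArg (MvPolynomial.coeff α₀) h
    rw [coeff_truncTotal _ (by omega)] at this
    exact hα₀' this
  have hdeg : ∀ α ∈ p.support, α.degree = N := by
    intro α hα
    rw [MvPolynomial.mem_support_iff] at hα
    have h1 : α.degree < N + 1 := by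
      by_contra hc
      exact hα (coeff_truncTotal_eq_zero _ (by omega))
    rw [coeff_truncTotal _ h1] at hα
    by_contra hc
    exact hα (hmin α (by omega))
  -- The factor `X 0` also secures `a 0 ≠ 0`, which makes the substitution below invertible.
  obtain ⟨a, ha⟩ : ∃ a : Fin (n + 1) → ℂ, MvPolynomial.eval a (MvPolynomial.X 0 * p) ≠ 0 := by
    by_contra hc
    push Not at hc
    exact mul_ne_zero (MvPolynomial.X_ne_zero 0) hp (MvPolynomial.funext fun a => by
      rw [hc a, map_zero])
  rw [map_mul, MvPolynomial.eval_X] at ha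
  have ha0 : a 0 ≠ 0 := left_ne_zero_of_mul ha
  let y : Fin (n + 1) → PS (n + 1) := fun i =>
    if i = 0 then a 0 • X 0 else X i + a i • X 0
  have hy : ∀ i, y i ∈ maximalIdeal (PS (n + 1)) := by
    intro i
    rw [mem_maximalIdeal_iff]
    by_cases hi : i = 0 <;> simp [y, hi]
  have hlin : LinearIndependent ℂ fun i => linCoeff (n + 1) (y i) := by
    rw [Fintype.linearIndependent_iff]
    intro c hc
    have hval : ∀ i k, linCoeff (n + 1) (y i) k =
        if i = 0 then a 0 * (Pi.single 0 1 : Fin (n + 1) → ℂ) k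
        else (Pi.single i 1 : Fin (n + 1) → ℂ) k + a i * (Pi.single 0 1 : Fin (n + 1) → ℂ) k := by
      intro i k
      by_cases hi : i = 0
      · simp only [y, hi, if_true, map_smul, linCoeff_X, Pi.smul_apply, smul_eq_mul]
      · simp only [y, hi, if_false, map_add, map_smul, linCoeff_X, Pi.add_apply, Pi.smul_apply,
          smul_eq_mul]
    have hne : ∀ i, i ≠ 0 → c i = 0 := by
      intro i hi
      have := congrFun hc i
      rw [Finset.sum_apply, Finset.sum_eq_single i] at this
      · simpa [hval, hi] using this
      · intro k _ hk
        simp only [Pi.smul_apply, hval, smul_eq_mul]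
        by_cases hk0 : k = 0
        · simp [hk0, hi]
        · simp [hk0, hi, hk.symm]
      · simp
    intro i
    by_cases hi : i = 0
    · subst hi
      have := congrFun hc 0
      rw [Finset.sum_apply, Finset.sum_eq_single 0] at this
      · simpa [hval, ha0] using this
      · intro k _ hk
        simp [hne k hk]
      · simp
    · exact hne i hi
  refine ⟨coordEquiv y hy hlin, fun hzero => ?_⟩
  have h1 : coeff (Finsupp.single 0 N) (coordEquiv y hy hlin f) = 0 := by
    rw [← coeff_restrictLine, hzero, map_zero]
  have h2 : coeff (Finsupp.single 0 N) (coordEquiv y hy hlin (p : PS (n + 1))) = 0 := by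
    have := coeff_eq_zero_of_mem_pow (algHom_mem_pow (coordEquiv y hy hlin).toAlgHom
      (sub_truncTotal_mem (N + 1) f)) (α := Finsupp.single 0 N) (by simp)
    rw [map_sub, map_sub, sub_eq_zero] at this
    exact this.symm.trans h1
  have h3 : ∀ i, restrictLine n (y i) = PowerSeries.C (a i) * PowerSeries.X := by
    intro i
    ext k
    rw [coeff_restrictLine, PowerSeries.coeff_C_mul, PowerSeries.coeff_X]
    by_cases hi : i = 0
    · subst hi
      simp [y, coeff_X, Finsupp.single_eq_single_iff]
    · simp only [y, hi, if_false, map_add, coeff_X, coeff_smul]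
      by_cases hk : k = 1
      · have : ¬ (Finsupp.single 0 1 : Fin (n + 1) →₀ ℕ) = Finsupp.single i 1 := by
          rw [Finsupp.single_left_inj one_ne_zero]; exact Ne.symm hi
        simp [hk, this]
      · simp [hk, Finsupp.single_eq_single_iff]
  have h4 : restrictLine n (coordEquiv y hy hlin (p : PS (n + 1))) =
      PowerSeries.C (MvPolynomial.eval a p) * PowerSeries.X ^ N := by
    have h5 : coordEquiv y hy hlin (p : PS (n + 1)) = MvPolynomial.aeval y p := by
      rw [show coordEquiv y hy hlin (p : PS (n + 1)) =
        (coordEquiv y hy hlin).toAlgHom (p : PS (n + 1)) from rfl, algHom_coe_polynomial]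
      congr 2
      ext1 i
      exact coordEquiv_X y hy hlin i
    rw [h5, MvPolynomial.aeval_def, MvPolynomial.eval₂_eq, map_sum, MvPolynomial.eval_eq, map_sum,
      Finset.sum_mul]
    refine Finset.sum_congr rfl fun α hα => ?_
    rw [map_mul, map_prod]
    have h6 : restrictLine n (algebraMap ℂ (PS (n + 1)) (MvPolynomial.coeff α p)) =
        PowerSeries.C (MvPolynomial.coeff α p) := by
      change PowerSeries.map (constantCoeff (σ := Fin n) (R := ℂ)) (finSuccEquiv ℂ n (C _)) = _
      rw [finSuccEquiv_C, PowerSeries.map_C, constantCoeff_C]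
    rw [h6, map_mul, mul_assoc]
    congr 1
    simp only [map_pow, h3, mul_pow, map_prod, Finset.prod_mul_distrib]
    congr 1
    rw [Finset.prod_pow_eq_pow_sum, ← hdeg α hα]
    rfl
  rw [← coeff_restrictLine, h4, PowerSeries.coeff_C_mul, PowerSeries.coeff_X_pow_self, mul_one]
    at h2
  exact right_ne_zero_of_mul ha h2

/-- Kaplansky's criterion: it suffices that every nonzero prime ideal contains a prime element.
After a coordinate change Weierstrass preparation applies to one of its elements. -/
theorem uniqueFactorizationMonoid_succ (h : UniqueFactorizationMonoid (PS n)) :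
    UniqueFactorizationMonoid (PS (n + 1)) := by
  rw [UniqueFactorizationMonoid.iff_exists_prime_mem_of_isPrime]
  intro P hP0 hP
  obtain ⟨f, hfP, hf⟩ := Submodule.exists_mem_ne_zero_of_ne_bot hP0
  obtain ⟨φ, hφ⟩ := exists_coordinates_regular hf
  let e : PS (n + 1) ≃+* PowerSeries (PS n) :=
    (φ : PS (n + 1) ≃+* PS (n + 1)).trans (finSuccEquiv ℂ n : PS (n + 1) ≃+* PowerSeries (PS n))
  have hP' : (P.comap e.symm.toRingHom).IsPrime := Ideal.IsPrime.comap _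
  have hmem : e f ∈ P.comap e.symm.toRingHom := by
    rw [Ideal.mem_comap]
    simpa using hfP
  have hne : (e f).map (residue (PS n)) ≠ 0 := by
    intro h0
    apply hφ
    ext k
    have := congrArg (PowerSeries.coeff k) h0
    rw [PowerSeries.coeff_map, map_zero, residue_eq_zero_iff, mem_maximalIdeal_iff] at this
    exact this
  obtain ⟨x, hx, hxp⟩ := exists_prime_mem_of_map_ne_zero hmem hne
  exact ⟨e.symm x, hx, (MulEquiv.prime_iff e.symm).2 hxp⟩

instance : UniqueFactorizationMonoid (PS n) := by
  induction n with
  | zero =>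
    exact (isEmptyEquiv (σ := Fin 0) (R := ℂ)).symm.toMulEquiv.uniqueFactorizationMonoid
      inferInstance
  | succ n ih => exact uniqueFactorizationMonoid_succ ih

/-! ### Stable ideals and homogeneous eigencoordinates -/

/-- If every cofactor of `g` in its components were a nonunit, summing the components would put `g`
in the closed ideal `𝔪 g`, which is impossible for `g ≠ 0`. -/
theorem exists_associated_comp {Γ : Type*} [AddCommGroup Γ] {ω : (Fin n →₀ ℕ) →+ Γ} {g : PS n}
    (hg : g ≠ 0) (h : ∀ c, g ∣ comp ω c g) : ∃ c, Associated g (comp ω c g) := by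
  by_contra hc
  push Not at hc
  have hmem : ∀ c, comp ω c g ∈ maximalIdeal (PS n) * Ideal.span {g} := by
    intro c
    obtain ⟨a, ha⟩ := h c
    rw [Ideal.mem_mul_span_singleton]
    refine ⟨a, ?_, by rw [ha, mul_comm]⟩
    rw [mem_maximalIdeal, mem_nonunits_iff]
    exact fun hu => hc c (ha ▸ associated_mul_unit_right g a hu)
  have : g ∈ maximalIdeal (PS n) * Ideal.span {g} := by
    refine mem_ideal_of_forall_mem_sup fun k => ?_
    obtain ⟨F, hF⟩ := exists_finset_weights ω k
    exact Submodule.mem_sup.2 ⟨_, sum_mem fun c _ => hmem c, _, sub_sum_comp_mem hF g,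
      add_sub_cancel _ _⟩
  rw [Ideal.mem_mul_span_singleton] at this
  obtain ⟨z, hz, hzg⟩ := this
  have h1 : z = 1 := mul_right_cancel₀ hg (by rw [hzg, one_mul])
  rw [h1] at hz
  exact (Ideal.ne_top_iff_one _).1 (Ideal.IsPrime.ne_top inferInstance) hz

/-- A monomial is sent to a product of generalized eigenfunctions, whose eigenvalue is its
`μ`-weight; truncation reduces a series to such monomials. -/
theorem algHom_mem_formalEigenspace {D : VF n} (hD : D ∈ vanishing n) (φ : PS n →ₐ[ℂ] PS n)
    {μ : Fin n → ℂ} (hφ : ∀ j, φ (X j) ∈ formalEigenspace D (μ j)) {c : ℂ} {p : PS n}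
    (hp : IsHomog (wtHom μ) c p) : φ p ∈ formalEigenspace D c := by
  refine mem_formalEigenspace_of_closure hD fun k => ?_
  refine ⟨φ (truncTotal k p : MvPolynomial (Fin n) ℂ), ?_, ?_⟩
  · rw [algHom_coe_polynomial, MvPolynomial.aeval_def, MvPolynomial.eval₂_eq]
    refine sum_mem fun α hα => ?_
    have hα' : wt μ α = c := by
      rw [MvPolynomial.mem_support_iff] at hα
      have h1 : α.degree < k := by
        by_contra hc
        exact hα (coeff_truncTotal_eq_zero _ (not_lt.1 hc))
      rw [coeff_truncTotal _ h1] at hα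
      exact hp α hα
    change C _ * _ ∈ _
    rw [← smul_eq_C_mul, ← hα', wt]
    refine Submodule.smul_mem _ _ ?_
    have h2 : ∏ i ∈ α.support, φ (X i) ^ α i = ∏ i, φ (X i) ^ α i :=
      Finset.prod_subset (Finset.subset_univ _) fun i _ hi => by
        rw [Finsupp.notMem_support_iff.1 hi, pow_zero]
    rw [h2]
    simp_rw [mul_comm (μ _)]
    exact prod_mem_formalEigenspace _ fun i => pow_mem_formalEigenspace (hφ i) _
  · rw [← map_sub]
    exact algHom_mem_pow φ (sub_truncTotal_mem k p)

/-- Components with respect to eigencoordinates of `D` of elements of a `D`-stable ideal. -/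
theorem algHom_comp_mem_of_stable {D : VF n} (hD : D ∈ vanishing n) (φ : PS n →ₐ[ℂ] PS n)
    {μ : Fin n → ℂ} (hφ : ∀ j, φ (X j) ∈ formalEigenspace D (μ j)) {J : Ideal (PS n)}
    (hJ : ∀ x ∈ J, D x ∈ J) {p : PS n} (hp : φ p ∈ J) (c : ℂ) :
    φ (comp (wtHom μ) c p) ∈ J := by
  classical
  refine mem_ideal_of_forall_mem_sup fun k => ?_
  obtain ⟨F, hF⟩ := exists_finset_weights (wtHom μ) k
  have hF' : ∀ α : Fin n →₀ ℕ, α.degree < k → wtHom μ α ∈ insert c F :=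
    fun α hα => Finset.mem_insert_of_mem (hF α hα)
  -- Modulo `J + 𝔪 ^ k`, which is stable under `D`, only finitely many components survive. They have
  -- different eigenvalues and their sum vanishes, so each vanishes.
  refine mem_of_sum_mem_of_mem_formalEigenspace (D := D) (k := k) (F := insert c F)
    (J := (J ⊔ maximalIdeal (PS n) ^ k).restrictScalars ℂ)
    (h := fun c => φ (comp (wtHom μ) c p)) ?_ ?_ ?_ ?_ c (Finset.mem_insert_self c F)
  · intro x hx
    obtain ⟨a, ha, b, hb, rfl⟩ := Submodule.mem_sup.1 hx
    rw [map_add]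
    exact Submodule.add_mem_sup (hJ a ha) (apply_mem_of_mem_vanishing hD hb)
  · exact fun x hx => Submodule.mem_sup_right hx
  · exact fun c _ => algHom_mem_formalEigenspace hD φ hφ (isHomog_comp c p)
  · have : ∑ c ∈ insert c F, φ (comp (wtHom μ) c p) =
        φ p - φ (p - ∑ c ∈ insert c F, comp (wtHom μ) c p) := by
      rw [map_sub, map_sum, sub_sub_cancel]
    rw [this]
    exact sub_mem (Submodule.mem_sup_left hp)
      (Submodule.mem_sup_right (algHom_mem_pow φ (sub_sum_comp_mem hF' p)))

theorem diagonalField_mem_vanishing (d : Fin n → ℂ) : diagonalField d ∈ vanishing n :=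
  linearField_mem_vanishing _

theorem comp_mem_of_stable {d : Fin n → ℂ} {J : Ideal (PS n)}
    (hJ : ∀ x ∈ J, diagonalField d x ∈ J) {p : PS n} (hp : p ∈ J) (c : ℂ) :
    comp (wtHom d) c p ∈ J :=
  algHom_comp_mem_of_stable (diagonalField_mem_vanishing d) (AlgHom.id ℂ (PS n)) (μ := d)
    (fun j => mem_formalEigenspace_of_apply_eq_smul (diagonalField_apply_X d j)) hJ hp c

/-- A joint component is obtained by projecting to one weight after another. -/
theorem comp_jointWt_mem_of_stable {ι : Type*} [Finite ι] {d : ι → Fin n → ℂ} {J : Ideal (PS n)}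
    (hJ : ∀ i, ∀ x ∈ J, diagonalField (d i) x ∈ J) {p : PS n} (hp : p ∈ J) (w : ι → ℂ) :
    comp (jointWt d) w p ∈ J := by
  classical
  cases nonempty_fintype ι
  have key : ∀ t : Finset ι, ∃ q ∈ J, ∀ α, coeff α q =
      if ∀ i ∈ t, wt (d i) α = w i then coeff α p else 0 := by
    intro t
    induction t using Finset.induction_on with
    | empty => exact ⟨p, hp, fun α => by simp⟩
    | insert i t _ ih =>
      obtain ⟨q, hq, hqα⟩ := ih
      refine ⟨_, comp_mem_of_stable (hJ i) hq (w i), fun α => ?_⟩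
      rw [coeff_comp, hqα, wtHom_apply]
      simp only [Finset.forall_mem_insert]
      split_ifs <;> simp_all
  obtain ⟨q, hq, hqα⟩ := key Finset.univ
  convert hq using 1
  ext α
  rw [coeff_comp, hqα]
  congr 1
  simp [funext_iff]

theorem comp_mem_formalEigenspace {Γ : Type*} [AddCommGroup Γ] {ω : (Fin n →₀ ℕ) →+ Γ} {D : VF n}
    (hD : IsHomogDer ω 0 D) {μ : ℂ} {y : PS n} (hy : y ∈ formalEigenspace D μ) (c : Γ) :
    comp ω c y ∈ formalEigenspace D μ := by
  have hpow : ∀ N, (shift D μ ^ N) (comp ω c y) = comp ω c ((shift D μ ^ N) y) := by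
    intro N
    induction N with
    | zero => rfl
    | succ N ih =>
      rw [shift_pow_succ_apply, shift_pow_succ_apply, ih, shift_apply, shift_apply, map_sub,
        hD.comp_apply, map_smul]
  intro k
  obtain ⟨N, hN⟩ := hy k
  exact ⟨N, fun M hM => by rw [hpow]; exact comp_mem_pow c (hN M hM)⟩

/-- Homogeneous eigencoordinates of a homogeneous vector field of weight zero. -/
theorem exists_eigencoordinates {Γ : Type*} [AddCommGroup Γ] {ω : (Fin n →₀ ℕ) →+ Γ} {D : VF n}
    (hD : D ∈ vanishing n) (hω : IsHomogDer ω 0 D) :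
    ∃ (y : Fin n → PS n) (μ : Fin n → ℂ) (w : Fin n → Γ),
      (∀ k, y k ∈ formalEigenspace D (μ k)) ∧ (∀ k, y k ∈ maximalIdeal (PS n)) ∧
      (∀ k, IsHomog ω (w k) (y k)) ∧ LinearIndependent ℂ fun k => linCoeff n (y k) := by
  -- Linear parts of homogeneous generalized eigenfunctions. They span because projecting to weights
  -- preserves the formal eigenspaces of a field of weight zero; a basis chosen among them gives the
  -- coordinates.
  let S : Set (Fin n → ℂ) := {v | ∃ y μ w, y ∈ formalEigenspace D μ ∧
    y ∈ maximalIdeal (PS n) ∧ IsHomog ω w y ∧ linCoeff n y = v}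
  have hS : Submodule.span ℂ S = ⊤ := by
    rw [eq_top_iff, ← Module.End.iSup_maxGenEigenspace_eq_top (Matrix.toLin' (linearMatrix D)),
      iSup_le_iff]
    intro μ v hv
    obtain ⟨y, hy, hym, rfl⟩ := exists_mem_formalEigenspace_linCoeff hD hv
    obtain ⟨F, hF⟩ := exists_finset_weights ω 2
    have hm : ∀ c, comp ω c y ∈ maximalIdeal (PS n) := by
      intro c
      have := comp_mem_pow (ω := ω) c (k := 1) (h := y) (by simpa using hym)
      simpa using this
    have h2 := sub_sum_comp_mem hF y
    rw [mem_sq_iff (sub_mem hym (sum_mem fun c _ => hm c)), map_sub, map_sum, sub_eq_zero] at h2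
    rw [h2]
    exact sum_mem fun c _ => Submodule.subset_span
      ⟨comp ω c y, μ, c, comp_mem_formalEigenspace hω hy c, hm c, isHomog_comp c y, rfl⟩
  obtain ⟨b, hbS, hspan, hlin⟩ := exists_linearIndependent ℂ S
  rw [hS] at hspan
  let B : Module.Basis b ℂ (Fin n → ℂ) := Module.Basis.mk hlin (by simp [hspan])
  have := Module.Finite.finite_basis B
  have := Fintype.ofFinite b
  have hcard : Fintype.card b = n := by
    rw [← Module.finrank_eq_card_basis B]; simp
  let e : Fin n ≃ b := (Fintype.equivFinOfCardEq hcard).symm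
  choose y μ w hy hm hw hv using fun k => hbS (e k).2
  refine ⟨y, μ, w, hy, hm, hw, ?_⟩
  simp_rw [hv]
  exact hlin.comp e e.injective

/-! ### Semisimple parts are diagonal symmetries -/

theorem isSemisimple_toLin'_diagonal (e : Fin n → ℂ) :
    Module.End.IsSemisimple (Matrix.toLin' (Matrix.diagonal e)) := by
  classical
  -- The image discards repeated eigenvalues, which makes `p` squarefree.
  let p : Polynomial ℂ := ∏ c ∈ Finset.univ.image e, (Polynomial.X - Polynomial.C c)
  have hp : Squarefree p := by
    refine Polynomial.Separable.squarefree ?_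
    exact Polynomial.separable_prod_X_sub_C_iff'.2 fun _ _ _ _ h => h
  refine Module.End.isSemisimple_of_squarefree_aeval_eq_zero hp ?_
  refine (Pi.basisFun ℂ (Fin n)).ext fun j => ?_
  have hj : Module.End.HasEigenvector (Matrix.toLin' (Matrix.diagonal e)) (e j)
      (Pi.basisFun ℂ (Fin n) j) := by
    refine ⟨Module.End.mem_eigenspace_iff.2 ?_, (Pi.basisFun ℂ (Fin n)).ne_zero j⟩
    ext i
    rw [Matrix.toLin'_apply, Matrix.mulVec_diagonal]
    by_cases hij : i = j
    · simp [hij]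
    · simp [hij]
  rw [Module.End.aeval_apply_of_hasEigenvector hj]
  have : p.eval (e j) = 0 := by
    rw [Polynomial.eval_prod]
    exact Finset.prod_eq_zero (Finset.mem_image_of_mem e (Finset.mem_univ j)) (by simp)
  rw [this]
  simp

theorem isNilpotent_of_forall_exists {M : Matrix (Fin n) (Fin n) ℂ} {v : Fin n → Fin n → ℂ}
    (hv : LinearIndependent ℂ v)
    (h : ∀ k, v k ∈ Module.End.maxGenEigenspace (Matrix.toLin' M) 0) : IsNilpotent M := by
  rw [← Matrix.isNilpotent_toLin'_iff, Module.End.isNilpotent_iff_of_finite]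
  intro x
  have hspan : Submodule.span ℂ (Set.range v) = ⊤ :=
    hv.span_eq_top_of_card_eq_finrank' (by simp)
  have hx : x ∈ Submodule.span ℂ (Set.range v) := hspan ▸ Submodule.mem_top
  have hle : Submodule.span ℂ (Set.range v) ≤
      Module.End.maxGenEigenspace (Matrix.toLin' M) 0 := by
    rw [Submodule.span_le]
    rintro _ ⟨k, rfl⟩
    exact h k
  simpa using (Module.End.mem_maxGenEigenspace _ _ _).1 (hle hx)

/-- The vector field `φ⁻¹ ∘ D ∘ φ`. -/
def conj (φ : PS n ≃ₐ[ℂ] PS n) : VF n →ₗ[ℂ] VF n where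
  toFun D := Derivation.mk' (φ.symm.toLinearMap ∘ₗ (D : PS n →ₗ[ℂ] PS n) ∘ₗ φ.toLinearMap)
    (fun a b => by simp)
  map_add' D E := by ext1 h; exact map_add φ.symm _ _
  map_smul' c D := by ext1 h; exact map_smul φ.symm _ _

theorem conj_apply (φ : PS n ≃ₐ[ℂ] PS n) (D : VF n) (h : PS n) :
    conj φ D h = φ.symm (D (φ h)) := rfl

theorem conj_injective (φ : PS n ≃ₐ[ℂ] PS n) : Function.Injective (conj φ) := by
  intro D E h
  ext1 x
  have := congrArg (fun F : VF n => F (φ.symm x)) h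
  simpa [conj_apply] using this

instance finite_diagonalLog (g : PS n) : Module.Finite ℂ (diagonalLog g) := by
  let L : diagonalLog g →ₗ[ℂ] (Matrix (Fin n) (Fin n) ℂ) :=
    linearMatrix ∘ₗ (diagonalLog g).subtype
  refine Module.Finite.of_injective L fun σ τ h => Subtype.ext ?_
  have h' : linearMatrix (σ : VF n) = linearMatrix (τ : VF n) := h
  rw [σ.2.2.1.1, τ.2.2.1.1, h']

theorem diagonalField_mem_diagonalLog {d : Fin n → ℂ} {g : PS n} {c : ℂ}
    (h : diagonalField d g = c • g) : diagonalField d ∈ diagonalLog g :=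
  ⟨mem_logDer_iff.2 (h ▸ by rw [smul_eq_C_mul]; exact dvd_mul_left _ _),
    isDiagonalField_diagonalField d, c, h⟩

theorem isHomogDer_linearField_linearMatrix {e : Fin n → ℂ} {c : ℂ} {D : VF n}
    (hD : IsHomogDer (wtHom e) c D) : IsHomogDer (wtHom e) c (linearField (linearMatrix D)) := by
  intro j α hα
  rw [linearField_apply_X, map_sum] at hα
  obtain ⟨i, -, hi⟩ := Finset.exists_ne_zero_of_sum_ne_zero hα
  rw [coeff_smul, coeff_X] at hi
  obtain ⟨h1, h2⟩ := ne_zero_and_ne_zero_of_mul hi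
  rw [Ne, ite_eq_right_iff, Classical.not_imp] at h2
  rw [h2.1]
  exact hD j _ h1

/-- If the diagonal symmetries of `g` have maximal dimension, they contain the semisimple part of
every logarithmic vector field commuting with all of them. -/
theorem exists_isSemisimplePart_mem_diagonalLog {g : PS n} (hg : g ≠ 0)
    (hmax : ∀ g', ContactEquiv g g' →
      Module.finrank ℂ (diagonalLog g') ≤ Module.finrank ℂ (diagonalLog g))
    {δ : VF n} (hδ : δ ∈ logDer g) (hδm : δ ∈ vanishing n)
    (hcomm : ∀ σ ∈ diagonalLog g, ⁅σ, δ⁆ = 0) :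
    ∃ S ∈ diagonalLog g, IsSemisimplePart S δ := by
  -- The joint weight is indexed by all diagonal symmetries, so no basis has to be chosen.
  let d : diagonalLog g → Fin n → ℂ := fun σ => (linearMatrix (σ : VF n)).diag
  have hd : ∀ σ : diagonalLog g, diagonalField (d σ) = σ := fun σ =>
    (σ.2.2.1.eq_diagonalField).symm
  have hω : IsHomogDer (jointWt d) 0 δ := isHomogDer_jointWt_iff.2 fun σ => by
    rw [hd, hcomm σ σ.2]; simp
  obtain ⟨y, μ, w, hyE, hym, hyw, hlin⟩ := exists_eigencoordinates hδm hω
  let φ := coordEquiv y hym hlin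
  have hφX : ∀ j, φ (X j) = y j := coordEquiv_X y hym hlin
  have hg' : φ.symm g ≠ 0 := by simpa using hg
  have hstable : ∀ x ∈ Ideal.span {g}, δ x ∈ Ideal.span {g} := hδ
  have hdvd : ∀ c, φ.symm g ∣ comp (wtHom μ) c (φ.symm g) := by
    intro c
    have h1 := algHom_comp_mem_of_stable hδm (φ : PS n →ₐ[ℂ] PS n) (μ := μ)
      (fun j => by simpa [hφX] using hyE j) hstable (p := φ.symm g)
      (by simp) c
    rw [Ideal.mem_span_singleton] at h1
    have h2 := map_dvd φ.symm h1
    simpa using h2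
  -- In the eigencoordinates, a unit multiple `g'` of the transformed `g` is homogeneous for the
  -- eigenvalues of `δ`.
  obtain ⟨c, u, hu⟩ := exists_associated_comp hg' hdvd
  set g' := comp (wtHom μ) c (φ.symm g) with hg'def
  have hcontact : ContactEquiv g g' := ⟨φ.symm, u, by rw [← hu, mul_comm]⟩
  -- The old symmetries stay diagonal because each new coordinate is homogeneous for the joint
  -- weight.
  have hconj : ∀ σ : diagonalLog g, conj φ σ = diagonalField fun k => w k σ := by
    intro σ
    refine derivation_ext fun k => ?_
    rw [conj_apply, hφX, diagonalField_apply_X]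
    have := (isHomog_jointWt_iff.1 (hyw k)) σ
    rw [hd] at this
    rw [this, map_smul, ← hφX, AlgEquiv.symm_apply_apply]
  have hconj_mem : ∀ σ : diagonalLog g, conj φ σ ∈ diagonalLog g' := by
    intro σ
    obtain ⟨a, ha⟩ := σ.2.2.2
    have h1 : conj φ σ (φ.symm g) = a • φ.symm g := by
      rw [conj_apply, AlgEquiv.apply_symm_apply, ha, map_smul]
    rw [hconj] at h1 ⊢
    refine diagonalField_mem_diagonalLog (c := a) (diagonalField_apply_eq_smul_iff.2 ?_)
    rw [diagonalField_apply_eq_smul_iff] at h1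
    intro α hα
    refine h1 α fun h0 => hα ?_
    rw [hg'def, coeff_comp, h0, ite_self]
  let Φ : diagonalLog g →ₗ[ℂ] diagonalLog g' :=
    ((conj φ).comp (diagonalLog g).subtype).codRestrict _ hconj_mem
  have hΦ : Function.Injective Φ := by
    intro σ τ h
    exact Subtype.ext (conj_injective φ (congrArg Subtype.val h))
  -- Maximality turns the embedding of symmetries of `g` into those of `g'` into a bijection.
  have hfin : Module.finrank ℂ (diagonalLog g) = Module.finrank ℂ (diagonalLog g') :=
    le_antisymm (LinearMap.finrank_le_finrank_of_injective hΦ) (hmax g' hcontact)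
  have hsurj : Function.Surjective Φ := by
    have := @LinearMap.injective_iff_surjective_of_finrank_eq_finrank ℂ (diagonalLog g) _ _ _
      (diagonalLog g') _ _ _ _ hfin Φ
    exact this.1 hΦ
  have hμ : diagonalField μ ∈ diagonalLog g' :=
    diagonalField_mem_diagonalLog (diagonalField_apply_eq_smul_iff.2 (isHomog_comp c _))
  -- The eigenvalue field of `δ` is a symmetry of `g'`, hence comes from some `S` that is diagonal
  -- in the original coordinates.
  obtain ⟨S, hS⟩ := hsurj ⟨_, hμ⟩
  have hS' : conj φ S = diagonalField μ := congrArg Subtype.val hS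
  have hSy : ∀ k, (S : VF n) (y k) = μ k • y k := by
    intro k
    have := congrArg (fun D : VF n => φ (D (X k))) hS'
    simpa only [conj_apply, AlgEquiv.apply_symm_apply, hφX, diagonalField_apply_X, map_smul]
      using this
  have hSδ : ⁅(S : VF n), δ⁆ = 0 := hcomm S S.2
  have hSm : (S : VF n) ∈ vanishing n := hd S ▸ diagonalField_mem_vanishing _
  have hNm : δ - S ∈ vanishing n := sub_mem hδm hSm
  refine ⟨S, S.2, δ - S, by abel, ⟨S.2.2.1.1, ?_⟩, ⟨hNm, ?_⟩, ?_⟩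
  · rw [← hd S, linearMatrix_diagonalField]
    exact isSemisimple_toLin'_diagonal _
  · refine isNilpotent_of_forall_exists hlin fun k => ?_
    refine linCoeff_mem_maxGenEigenspace hNm ?_ (hym k)
    -- As `S` commutes with `δ`, it acts as the scalar `μ k` on all iterates of `y k`; there `δ - S`
    -- agrees with `δ - μ k`.
    have hpow : ∀ N, (S : VF n) ((shift δ (μ k) ^ N) (y k)) = μ k • (shift δ (μ k) ^ N) (y k) ∧
        (shift (δ - (S : VF n)) 0 ^ N) (y k) = (shift δ (μ k) ^ N) (y k) := by
      intro N
      induction N with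
      | zero => exact ⟨hSy k, rfl⟩
      | succ N ih =>
        obtain ⟨h1, h2⟩ := ih
        have h3 : (S : VF n) (δ ((shift δ (μ k) ^ N) (y k))) =
            δ ((S : VF n) ((shift δ (μ k) ^ N) (y k))) := by
          rw [← sub_eq_zero, ← Derivation.commutator_apply, hSδ, Derivation.zero_apply]
        constructor
        · rw [shift_pow_succ_apply, shift_apply, map_sub, h3, (S : VF n).map_smul, h1, δ.map_smul,
            smul_sub]
        · rw [shift_pow_succ_apply, h2, shift_pow_succ_apply, shift_apply, shift_apply,
            Derivation.sub_apply, h1, zero_smul, sub_zero]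
    intro m
    obtain ⟨N, hN⟩ := hyE k m
    exact ⟨N, fun M hM => by rw [(hpow M).2]; exact hN M hM⟩
  · have h1 : linearField (linearMatrix (S : VF n)) = diagonalField (d S) := by
      rw [hd]; exact S.2.2.1.1.symm
    have h2 : ⁅diagonalField (d S), δ - S⁆ = (0 : ℂ) • (δ - S) := by
      have : ⁅(S : VF n), δ - (S : VF n)⁆ = ⁅(S : VF n), δ⁆ := by
        ext1 h
        simp only [Derivation.commutator_apply, Derivation.sub_apply, map_sub]
        ring
      rw [hd, this, hSδ, zero_smul]
    rw [h1]
    have h3 := lie_diagonalField_eq_smul_iff.2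
      (isHomogDer_linearField_linearMatrix (lie_diagonalField_eq_smul_iff.1 h2))
    rw [h3, zero_smul]

/-! ### Rationality of the diagonal symmetries -/

/-- A complex solution of a system of homogeneous linear equations with integral coefficients is a
combination of rational solutions. -/
theorem mem_span_rational_solutions {M : Set (Fin n → ℤ)} {d : Fin n → ℂ}
    (hd : ∀ m ∈ M, ∑ k, d k * m k = 0) :
    d ∈ Submodule.span ℂ {e : Fin n → ℂ | (∀ m ∈ M, ∑ k, e k * m k = 0) ∧
      ∀ k, ∃ q : ℚ, e k = q} := by
  classical
  -- Expand the entries of `d` over a `ℚ`-basis of `ℂ`; each coordinate vector satisfies the same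
  -- integral equations.
  let B := Module.Free.chooseBasis ℚ ℂ
  let T := Finset.univ.biUnion fun k => (B.repr (d k)).support
  have hsum : d = ∑ b ∈ T, B b • fun k => ((B.repr (d k) b : ℚ) : ℂ) := by
    ext k
    rw [Finset.sum_apply]
    conv_lhs => rw [← B.linearCombination_repr (d k), Finsupp.linearCombination_apply,
      Finsupp.sum]
    rw [Finset.sum_subset (Finset.subset_biUnion_of_mem (fun k => (B.repr (d k)).support)
      (Finset.mem_univ k))]
    · refine Finset.sum_congr rfl fun b _ => ?_
      rw [Pi.smul_apply, smul_eq_mul, Rat.smul_def, mul_comm]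
    · intro b _ hb
      rw [Finsupp.notMem_support_iff.1 hb, zero_smul]
  rw [hsum]
  refine sum_mem fun b _ => Submodule.smul_mem _ _ (Submodule.subset_span ⟨fun m hm => ?_,
    fun k => ⟨_, rfl⟩⟩)
  have h1 : ∑ k, (m k : ℚ) • d k = 0 := by
    rw [← hd m hm]
    refine Finset.sum_congr rfl fun k _ => ?_
    rw [Rat.smul_def, mul_comm]
    simp
  have h2 := congrArg (fun z => B.repr z b) h1
  simp only [map_sum, map_smul, Finsupp.coe_finsetSum, Finset.sum_apply, Finsupp.smul_apply,
    smul_eq_mul, map_zero, Finsupp.zero_apply] at h2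
  have h3 := congrArg (fun q : ℚ => (q : ℂ)) h2
  push_cast at h3
  rw [← h3]
  exact Finset.sum_congr rfl fun k _ => mul_comm _ _

/-- Fixing one monomial `α₀` of `g` expresses equality of all weights as homogeneous equations with
integral coefficients. -/
theorem diagonalField_mem_diagonalLog_iff {d : Fin n → ℂ} {g : PS n} {α₀ : Fin n →₀ ℕ}
    (hα₀ : coeff α₀ g ≠ 0) : diagonalField d ∈ diagonalLog g ↔
      ∀ m ∈ {m : Fin n → ℤ | ∃ α, coeff α g ≠ 0 ∧ ∀ k, m k = α k - α₀ k}, ∑ k, d k * m k = 0 := by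
  have hwt : ∀ α : Fin n →₀ ℕ, ∑ k, d k * (((α k : ℤ) - (α₀ k : ℤ) : ℤ) : ℂ) =
      wt d α - wt d α₀ := by
    intro α
    rw [wt, wt, ← Finset.sum_sub_distrib]
    refine Finset.sum_congr rfl fun k _ => ?_
    push_cast
    ring
  constructor
  · rintro ⟨-, -, c, hc⟩ m ⟨α, hα, hm⟩
    rw [diagonalField_apply_eq_smul_iff] at hc
    simp_rw [hm, hwt]
    have h1 : wt d α = c := hc α hα
    have h2 : wt d α₀ = c := hc α₀ hα₀
    rw [h1, h2, sub_self]
  · intro h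
    refine diagonalField_mem_diagonalLog (c := wt d α₀)
      (diagonalField_apply_eq_smul_iff.2 fun α hα => ?_)
    have := h (fun k => α k - α₀ k) ⟨α, hα, fun k => rfl⟩
    rw [hwt, sub_eq_zero] at this
    exact this

/-- The space of diagonal symmetries has a basis with rational eigenvalues. -/
theorem exists_rational_basis_diagonalLog {g : PS n} (hg : g ≠ 0) :
    ∃ d : Fin (Module.finrank ℂ (diagonalLog g)) → Fin n → ℂ,
      (∀ i k, ∃ q : ℚ, d i k = q) ∧ LinearIndependent ℂ (fun i => diagonalField (d i)) ∧
      Submodule.span ℂ (Set.range fun i => diagonalField (d i)) = diagonalLog g := by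
  obtain ⟨α₀, hα₀⟩ := MvPowerSeries.ne_zero_iff_exists_coeff_ne_zero g |>.1 hg
  let R : Set (VF n) := {σ | σ ∈ diagonalLog g ∧ ∃ d : Fin n → ℂ, (∀ k, ∃ q : ℚ, d k = q) ∧
    σ = diagonalField d}
  let L : (Fin n → ℂ) →ₗ[ℂ] VF n :=
    { toFun := diagonalField, map_add' := diagonalField_add, map_smul' := diagonalField_smul }
  have hR : Submodule.span ℂ R = diagonalLog g := by
    refine le_antisymm (Submodule.span_le.2 fun σ hσ => hσ.1) fun σ hσ => ?_
    obtain ⟨d, rfl⟩ : ∃ d, σ = diagonalField d := ⟨_, hσ.2.1.eq_diagonalField⟩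
    have h1 := mem_span_rational_solutions ((diagonalField_mem_diagonalLog_iff hα₀).1 hσ)
    have h2 := Submodule.mem_map_of_mem (f := L) h1
    rw [Submodule.map_span] at h2
    refine Submodule.span_mono ?_ h2
    rintro _ ⟨e, ⟨he, hq⟩, rfl⟩
    exact ⟨(diagonalField_mem_diagonalLog_iff hα₀).2 he, e, hq, rfl⟩
  obtain ⟨b, hbR, hspan, hlin⟩ := exists_linearIndependent ℂ R
  rw [hR] at hspan
  have hrange : Submodule.span ℂ (Set.range ((↑) : b → VF n)) = diagonalLog g := by
    rw [Subtype.range_coe, hspan]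
  let B : Module.Basis b ℂ (diagonalLog g) :=
    (Module.Basis.span hlin).map (LinearEquiv.ofEq _ _ hrange)
  have := Module.Finite.finite_basis B
  have := Fintype.ofFinite b
  let e : Fin (Module.finrank ℂ (diagonalLog g)) ≃ b :=
    (Fintype.equivFinOfCardEq (Module.finrank_eq_card_basis B).symm).symm
  choose d hd hσ using fun i => (hbR (e i).2).2
  have hfun : (fun i => diagonalField (d i)) = ((↑) : b → VF n) ∘ e := by
    ext1 i
    exact (hσ i).symm
  refine ⟨d, hd, ?_, ?_⟩
  · rw [hfun]
    exact hlin.comp e e.injective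
  · rw [hfun, EquivLike.range_comp, hrange]

/-! ### Irreducible factors and contact equivalence -/

/-- For `g = p ^ l * q` with `p ∤ q`, the Leibniz rule gives `p ∣ q * l * D p`, and `l` is a unit in
characteristic zero. -/
theorem prime_dvd_derivation {g p : PS n} (hg : g ≠ 0) (hp : Prime p) (hpg : p ∣ g) {D : VF n}
    (hD : D ∈ logDer g) : p ∣ D p := by
  obtain ⟨l, q, hq, rfl⟩ : ∃ l q, ¬ p ∣ q ∧ g = p ^ l * q := by
    obtain ⟨q, h1, h2⟩ := (FiniteMultiplicity.of_prime_left hp hg).exists_eq_pow_mul_and_not_dvd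
    exact ⟨_, q, h2, h1⟩
  have hl : l ≠ 0 := by
    rintro rfl
    exact hq (by simpa using hpg)
  obtain ⟨l, rfl⟩ := Nat.exists_eq_succ_of_ne_zero hl
  rw [mem_logDer_iff, Derivation.leibniz, Derivation.leibniz_pow] at hD
  have h1 : p ^ (l + 1) ∣ q • ((l + 1) • p ^ (l + 1 - 1) • D p) := by
    refine (dvd_add_right ?_).1 ((dvd_mul_right _ q).trans hD)
    rw [smul_eq_mul]
    exact dvd_mul_right _ _
  simp only [Nat.add_sub_cancel, smul_eq_mul, nsmul_eq_mul] at h1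
  have h2 : p ^ l * p ∣ p ^ l * (q * (((l + 1 : ℕ) : PS n) * D p)) := by
    rw [← pow_succ]
    convert h1 using 1
    ring
  have h3 := (mul_dvd_mul_iff_left (pow_ne_zero l hp.ne_zero)).1 h2
  have h4 := (hp.dvd_or_dvd h3).resolve_left hq
  refine (hp.dvd_or_dvd h4).resolve_left fun h5 => hp.not_isUnit (isUnit_of_dvd_unit h5 ?_)
  rw [MvPowerSeries.isUnit_iff_constantCoeff, map_natCast]
  exact (Nat.cast_ne_zero.2 (Nat.succ_ne_zero l)).isUnit

theorem exists_irreducible_factorization {R : Type*} [CommRing R] [IsDomain R]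
    [UniqueFactorizationMonoid R] {g : R} (hg : g ≠ 0) :
    ∃ (m : ℕ) (p : Fin m → R) (l : Fin m → ℕ), (∀ j, Irreducible (p j)) ∧
      (∀ j k, j ≠ k → ¬ Associated (p j) (p k)) ∧ (∀ j, 0 < l j) ∧
      Associated (∏ j, p j ^ l j) g := by
  classical
  let _ := UniqueFactorizationMonoid.strongNormalizationMonoid (α := R)
  let s := UniqueFactorizationMonoid.normalizedFactors g
  let e : Fin s.toFinset.card ≃ s.toFinset := s.toFinset.equivFin.symm
  have hmem : ∀ j, (e j : R) ∈ s := fun j => Multiset.mem_toFinset.1 (e j).2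
  refine ⟨s.toFinset.card, fun j => e j, fun j => s.count (e j : R),
    fun j => UniqueFactorizationMonoid.irreducible_of_normalized_factor _ (hmem j), ?_,
    fun j => Multiset.count_pos.2 (hmem j), ?_⟩
  · intro j k hjk h
    apply hjk
    apply e.injective
    apply Subtype.ext
    rw [← UniqueFactorizationMonoid.normalize_normalized_factor _ (hmem j),
      ← UniqueFactorizationMonoid.normalize_normalized_factor _ (hmem k)]
    exact normalize_eq_normalize_iff_associated.2 h
  · rw [e.prod_comp (fun x : s.toFinset => (x : R) ^ s.count (x : R)),
      Finset.prod_coe_sort s.toFinset (fun x => x ^ s.count x), ← Finset.prod_multiset_count]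
    exact UniqueFactorizationMonoid.prod_normalizedFactors hg

/-- Every power series whose principal ideal is stable under diagonal fields is associated to a
homogeneous one. -/
theorem exists_associated_isHomog {ι : Type*} [Finite ι] {d : ι → Fin n → ℂ} {p : PS n}
    (hp : p ≠ 0) (h : ∀ i, diagonalField (d i) ∈ logDer p) :
    ∃ q w, Associated p q ∧ IsHomog (jointWt d) w q := by
  obtain ⟨w, hw⟩ := exists_associated_comp (ω := jointWt d) hp fun w =>
    Ideal.mem_span_singleton.1 (comp_jointWt_mem_of_stable (J := Ideal.span {p})
      (fun i => h i) (Ideal.mem_span_singleton_self p) w)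
  exact ⟨_, w, hw, isHomog_comp w p⟩

theorem wt_rational {d : Fin n → ℂ} (hd : ∀ k, ∃ q : ℚ, d k = q) (α : Fin n →₀ ℕ) :
    ∃ q : ℚ, wt d α = q := by
  choose q hq using hd
  exact ⟨∑ k, q k * α k, by simp [wt, hq]⟩

theorem logDer_le_vanishing_of_contactEquiv {f g : PS n} (hfg : ContactEquiv f g)
    (hf : logDer f ≤ vanishing n) : logDer g ≤ vanishing n := by
  obtain ⟨φ, u, rfl⟩ := hfg
  intro D hD
  have h1 : conj φ D ∈ logDer f := by
    rw [logDer_eq_of_associated (f := (u : PS n) * φ f) (g := φ f)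
      (associated_unit_mul_left _ _ u.isUnit), mem_logDer_iff] at hD
    rw [mem_logDer_iff, conj_apply]
    simpa using map_dvd φ.symm hD
  have h2 := hf h1
  rw [mem_vanishing_iff]
  intro j
  have h3 : conj φ D (φ.symm (X j)) ∈ maximalIdeal (PS n) := by
    rw [derivation_apply_eq_sum]
    exact sum_mem fun k _ => Ideal.mul_mem_right _ _ (mem_vanishing_iff.1 h2 k)
  have h4 := algHom_mem_maximalIdeal φ.toAlgHom h3
  rw [conj_apply] at h4
  simpa using h4

theorem ContactEquiv.trans {f g h : PS n} (hfg : ContactEquiv f g) (hgh : ContactEquiv g h) :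
    ContactEquiv f h := by
  obtain ⟨φ, u, rfl⟩ := hfg
  obtain ⟨ψ, v, rfl⟩ := hgh
  refine ⟨φ.trans ψ, v * Units.map (ψ : PS n →* PS n) u, ?_⟩
  simp [mul_assoc]

theorem exists_isGreatest_diagonalDims (f : PS n) : ∃ s, IsGreatest (diagonalDims f) s := by
  have hne : (diagonalDims f).Nonempty := ⟨_, f, ⟨AlgEquiv.refl, 1, by simp⟩, rfl⟩
  have hbdd : BddAbove (diagonalDims f) := by
    refine ⟨Module.finrank ℂ (Matrix (Fin n) (Fin n) ℂ), ?_⟩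
    rintro _ ⟨g, -, rfl⟩
    refine LinearMap.finrank_le_finrank_of_injective
      (f := linearMatrix ∘ₗ (diagonalLog g).subtype) fun σ τ h => Subtype.ext ?_
    have h' : linearMatrix (σ : VF n) = linearMatrix (τ : VF n) := h
    rw [σ.2.2.1.1, τ.2.2.1.1, h']
  exact ⟨sSup _, Nat.sSup_mem hne hbdd, fun _ h => le_csSup hbdd h⟩

/-! ### Minimal systems of generators by Nakayama's lemma -/

theorem smul_sub_constantCoeff_smul_mem {N : Submodule (PS n) (VF n)} (a : PS n) {x : VF n}
    (hx : x ∈ N) : a • x - constantCoeff a • x ∈ maximalIdeal (PS n) • N := by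
  have h1 : constantCoeff a • x = (C (constantCoeff a) : PS n) • x := by
    ext1 h
    rw [Derivation.smul_apply, Derivation.smul_apply, smul_eq_C_mul, smul_eq_mul]
  have h2 : a • x - (C (constantCoeff a) : PS n) • x = (a - C (constantCoeff a)) • x := by
    ext1 h
    simp only [Derivation.sub_apply, Derivation.smul_apply, smul_eq_mul]
    ring
  rw [h1, h2]
  refine Submodule.smul_mem_smul ?_ hx
  rw [mem_maximalIdeal_iff]
  simp

/-- Modulo `𝔪 N`, spans over power series are spans over `ℂ`. -/
theorem mkQ_mem_span_of_mem_span {N : Submodule (PS n) (VF n)} {A : Set (VF n)}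
    (hA : ∀ x ∈ A, x ∈ N) {x : VF n} (hx : x ∈ Submodule.span (PS n) A) :
    ((maximalIdeal (PS n) • N).restrictScalars ℂ).mkQ x ∈ Submodule.span ℂ
      (((maximalIdeal (PS n) • N).restrictScalars ℂ).mkQ '' A) := by
  have hle : Submodule.span (PS n) A ≤ N := Submodule.span_le.2 hA
  refine Submodule.span_induction
    (p := fun x _ => ((maximalIdeal (PS n) • N).restrictScalars ℂ).mkQ x ∈ Submodule.span ℂ
      (((maximalIdeal (PS n) • N).restrictScalars ℂ).mkQ '' A)) ?_ ?_ ?_ ?_ hx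
  · intro x hx
    exact Submodule.subset_span ⟨x, hx, rfl⟩
  · rw [map_zero]; exact zero_mem _
  · intro x y _ _ hx hy
    rw [map_add]; exact add_mem hx hy
  · intro a x hxA hx
    have h1 := smul_sub_constantCoeff_smul_mem a (hle hxA)
    have h2 : ((maximalIdeal (PS n) • N).restrictScalars ℂ).mkQ (a • x) =
        constantCoeff a • ((maximalIdeal (PS n) • N).restrictScalars ℂ).mkQ x := by
      rw [← map_smul, ← sub_eq_zero, ← map_sub, Submodule.mkQ_apply,
        Submodule.Quotient.mk_eq_zero]
      exact h1
    rw [h2]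
    exact Submodule.smul_mem _ _ hx

theorem span_complex_le_span {A : Set (VF n)} {x : VF n} (hx : x ∈ Submodule.span ℂ A) :
    x ∈ Submodule.span (PS n) A := by
  refine Submodule.span_induction (p := fun x _ => x ∈ Submodule.span (PS n) A)
    (fun x hx => Submodule.subset_span hx) (zero_mem _) (fun _ _ _ _ => add_mem) ?_ hx
  intro c x _ hx
  have : c • x = (C c : PS n) • x := by
    ext1 h
    rw [Derivation.smul_apply, Derivation.smul_apply, smul_eq_C_mul, smul_eq_mul]
  rw [this]
  exact Submodule.smul_mem _ _ hx

theorem linearMatrix_eq_zero_of_mem_smul {N : Submodule (PS n) (VF n)} (hN : N ≤ vanishing n)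
    {D : VF n} (hD : D ∈ maximalIdeal (PS n) • N) : linearMatrix D = 0 := by
  have h1 : D ∈ maximalIdeal (PS n) ^ 2 • (⊤ : Submodule (PS n) (VF n)) := by
    have := Submodule.smul_mono (le_refl (maximalIdeal (PS n))) hN hD
    rwa [vanishing, ← smul_assoc, smul_eq_mul, ← pow_two] at this
  ext i j
  exact mem_pow_iff.1 (mem_pow_smul_top_iff.1 h1 j) _ (by simp)

/-- Extension of a family that is independent modulo `𝔪 N` to a minimal system of generators. -/
theorem exists_minimalGenerators {N : Submodule (PS n) (VF n)} {s : ℕ} {σ : Fin s → VF n}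
    {H : Set (VF n)} (hσ : ∀ i, σ i ∈ N) (hH : ∀ x ∈ H, x ∈ N)
    (hspan : N ≤ Submodule.span (PS n) (Set.range σ ∪ H))
    (hlin : LinearIndependent ℂ
      fun i => ((maximalIdeal (PS n) • N).restrictScalars ℂ).mkQ (σ i)) :
    ∃ (r : ℕ) (ν : Fin r → VF n), (∀ j, ν j ∈ H) ∧ IsMinimalGenerators (Sum.elim σ ν) N := by
  classical
  let v := ((maximalIdeal (PS n) • N).restrictScalars ℂ).mkQ
  have hσH : ∀ x ∈ Set.range σ ∪ H, x ∈ N := by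
    rintro x (⟨i, rfl⟩ | hx)
    exacts [hσ i, hH x hx]
  have hN : N = Submodule.span (PS n) (Set.range σ ∪ H) :=
    le_antisymm hspan (Submodule.span_le.2 hσH)
  have hfg : N.FG := IsNoetherian.noetherian N
  obtain ⟨t, htH, ht⟩ := (Submodule.fg_span_iff_fg_span_finset_subset _).1 (hN ▸ hfg)
  rw [← hN] at ht
  have hinj : Function.Injective σ := fun i j h => hlin.injective (congrArg v h)
  have hindep : LinearIndepOn ℂ v (Set.range σ) := (linearIndepOn_range_iff hinj v).2 hlin
  -- Extend `σ` by elements of the finite set `t` to a family whose classes form a basis of `N / 𝔪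
  -- N`.
  obtain ⟨b, hbt, hσb, htb, hb⟩ := exists_linearIndepOn_extension hindep
    (Set.subset_union_left (t := (t : Set (VF n))))
  have hbN : ∀ x ∈ b, x ∈ N := by
    intro x hx
    rcases hbt hx with ⟨i, rfl⟩ | hx
    exacts [hσ i, hσH x (htH hx)]
  have hbfin : (b \ Set.range σ).Finite :=
    ((Set.finite_range σ).union t.finite_toSet).subset (Set.sdiff_subset.trans hbt)
  have := hbfin.fintype
  let e : Fin (Fintype.card ↥(b \ Set.range σ)) ≃ ↥(b \ Set.range σ) :=
    (Fintype.equivFin _).symm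
  let ν : Fin (Fintype.card ↥(b \ Set.range σ)) → VF n := fun j => e j
  have hrange : Set.range (Sum.elim σ ν) = b := by
    have hν : Set.range ν = b \ Set.range σ := by
      rw [show ν = Subtype.val ∘ e from rfl, EquivLike.range_comp, Subtype.range_coe]
    rw [Set.Sum.elim_range, hν, Set.union_sdiff_cancel hσb]
  have hinj' : Function.Injective (Sum.elim σ ν) := by
    refine Function.Injective.sumElim hinj (Subtype.val_injective.comp e.injective) ?_
    intro i j h
    exact (e j).2.2 ⟨i, h⟩
  have hlin' : LinearIndependent ℂ (v ∘ Sum.elim σ ν) :=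
    (linearIndepOn_range_iff hinj' v).1 (by rw [hrange]; exact hb)
  refine ⟨_, ν, fun j => ?_, ?_, fun T hT => ?_⟩
  · rcases htH ((hbt (e j).2.1).resolve_left (e j).2.2) with h | h
    · exact absurd h (e j).2.2
    · exact h
  · rw [hrange]
    refine le_antisymm (Submodule.span_le.2 hbN) ?_
    refine Submodule.le_of_le_smul_of_le_jacobson_bot hfg (maximalIdeal_le_jacobson _) ?_
    conv_lhs => rw [ht]
    rw [Submodule.span_le]
    intro x hx
    have h1 := htb ⟨x, Or.inr hx, rfl⟩
    rw [SetLike.mem_coe, ← Submodule.map_span] at h1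
    obtain ⟨z, hz, hzx⟩ := h1
    rw [← sub_add_cancel x z, add_comm]
    refine Submodule.add_mem_sup (span_complex_le_span hz) ?_
    have h2 : v (x - z) = 0 := by rw [map_sub, hzx, sub_self]
    rwa [Submodule.mkQ_apply, Submodule.Quotient.mk_eq_zero] at h2
  · rw [Set.eq_univ_iff_forall]
    intro i
    by_contra hi
    have hiN : Sum.elim σ ν i ∈ Submodule.span (PS n) (Sum.elim σ ν '' T) := by
      rw [hT]
      exact hbN _ (hrange.le <| Set.mem_range_self i)
    have h1 := mkQ_mem_span_of_mem_span (N := N) (A := Sum.elim σ ν '' T) (by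
      rintro _ ⟨k, -, rfl⟩
      exact hbN _ (hrange.le <| Set.mem_range_self k)) hiN
    rw [← Set.image_comp] at h1
    -- Independence modulo `𝔪 N` forbids omitting any generator.
    exact hlin'.notMem_span_image hi h1

/-! ### Generation by diagonal and nilpotent fields -/

theorem isHomogDer_rational {ι : Type*} {d : ι → Fin n → ℂ} (hd : ∀ i k, ∃ q : ℚ, d i k = q)
    {w : ι → ℂ} {D : VF n} (hD : IsHomogDer (jointWt d) w D) (hD0 : D ≠ 0) (i : ι) :
    ∃ q : ℚ, w i = q := by
  obtain ⟨j, hj⟩ : ∃ j, D (X j) ≠ 0 := by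
    by_contra hc
    push Not at hc
    exact hD0 (derivation_ext fun j => by rw [hc j]; rfl)
  obtain ⟨α, hα⟩ := (MvPowerSeries.ne_zero_iff_exists_coeff_ne_zero _).1 hj
  have h1 := congrFun (hD j α hα) i
  obtain ⟨a, ha⟩ := wt_rational (hd i) α
  obtain ⟨b, hb⟩ := hd i j
  refine ⟨a - b, ?_⟩
  rw [Pi.add_apply, jointWt_apply, jointWt_apply, wt_single, ha, hb] at h1
  push_cast
  rw [h1]
  ring

theorem isHomog_rational {ι : Type*} {d : ι → Fin n → ℂ} (hd : ∀ i k, ∃ q : ℚ, d i k = q)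
    {w : ι → ℂ} {h : PS n} (hw : IsHomog (jointWt d) w h) (h0 : h ≠ 0) (i : ι) :
    ∃ q : ℚ, w i = q := by
  obtain ⟨α, hα⟩ := (MvPowerSeries.ne_zero_iff_exists_coeff_ne_zero _).1 h0
  obtain ⟨a, ha⟩ := wt_rational (hd i) α
  exact ⟨a, by rw [← ha, ← hw α hα, jointWt_apply]⟩

theorem lie_diagonalField_diagonalField (d e : Fin n → ℂ) :
    ⁅diagonalField d, diagonalField e⁆ = 0 := by
  refine derivation_ext fun j => ?_
  rw [Derivation.commutator_apply, diagonalField_apply_X, diagonalField_apply_X,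
    (diagonalField d).map_smul, (diagonalField e).map_smul, diagonalField_apply_X,
    diagonalField_apply_X, smul_comm, sub_self]
  rfl

theorem lie_eq_zero_of_mem_span {A : Set (VF n)} {D : VF n} (hA : ∀ σ ∈ A, ⁅σ, D⁆ = 0) {σ : VF n}
    (hσ : σ ∈ Submodule.span ℂ A) : ⁅σ, D⁆ = 0 := by
  refine Submodule.span_induction (p := fun σ _ => ⁅σ, D⁆ = 0) hA ?_ ?_ ?_ hσ
  · ext1 h
    simp [Derivation.commutator_apply]
  · intro x y _ _ hx hy
    have : ⁅x + y, D⁆ = ⁅x, D⁆ + ⁅y, D⁆ := by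
      ext1 h
      simp only [Derivation.commutator_apply, Derivation.add_apply, map_add]
      ring
    rw [this, hx, hy, add_zero]
  · intro c x _ hx
    have : ⁅c • x, D⁆ = c • ⁅x, D⁆ := by
      ext1 h
      simp only [Derivation.commutator_apply, Derivation.smul_apply, D.map_smul, smul_sub]
    rw [this, hx, smul_zero]

/-- `Der_g` is generated by its diagonal symmetries and by nilpotent homogeneous fields. -/
theorem logDer_le_span {g : PS n} (hg : g ≠ 0) (hvan : logDer g ≤ vanishing n) {s : ℕ}
    {d : Fin s → Fin n → ℂ} (hd : ∀ i k, ∃ q : ℚ, d i k = q)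
    (hspan : Submodule.span ℂ (Set.range fun i => diagonalField (d i)) = diagonalLog g)
    (hmax : ∀ g', ContactEquiv g g' →
      Module.finrank ℂ (diagonalLog g') ≤ Module.finrank ℂ (diagonalLog g)) :
    logDer g ≤ Submodule.span (PS n) (Set.range (fun i => diagonalField (d i)) ∪
      {ν | ν ∈ logDer g ∧ IsNilpotentField ν ∧
        ∀ i, ∃ q : ℚ, ⁅diagonalField (d i), ν⁆ = (q : ℂ) • ν}) := by
  set H := {ν : VF n | ν ∈ logDer g ∧ IsNilpotentField ν ∧
        ∀ i, ∃ q : ℚ, ⁅diagonalField (d i), ν⁆ = (q : ℂ) • ν} with hH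
  obtain ⟨w₀, hw₀⟩ : ∃ w, IsHomog (jointWt d) w g := by
    have : ∀ i, ∃ c : ℂ, diagonalField (d i) g = c • g := fun i =>
      (hspan.le (Submodule.subset_span ⟨i, rfl⟩) : diagonalField (d i) ∈ diagonalLog g).2.2
    choose w hw using this
    exact ⟨w, isHomog_jointWt_iff.2 hw⟩
  -- Weight zero is treated by splitting off the semisimple part; a field of nonzero weight is
  -- already nilpotent.
  have hhom : ∀ w D, D ∈ logDer g → IsHomogDer (jointWt d) w D →
      D ∈ Submodule.span (PS n) (Set.range (fun i => diagonalField (d i)) ∪ H) := by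
    intro w D hD hwD
    by_cases hD0 : D = 0
    · rw [hD0]; exact zero_mem _
    have hlie := isHomogDer_jointWt_iff.1 hwD
    by_cases hw : w = 0
    · subst hw
      have hcomm : ∀ i, ⁅diagonalField (d i), D⁆ = 0 := fun i => by
        rw [hlie i, Pi.zero_apply, zero_smul]
      obtain ⟨S, hS, N, rfl, -, hN, -⟩ := exists_isSemisimplePart_mem_diagonalLog hg hmax hD
        (hvan hD) fun σ hσ => lie_eq_zero_of_mem_span (by rintro _ ⟨i, rfl⟩; exact hcomm i)
          (hspan.ge hσ)
      rw [← hspan] at hS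
      refine add_mem (Submodule.span_mono Set.subset_union_left (span_complex_le_span hS))
        (Submodule.subset_span (Or.inr ⟨?_, hN, fun i => ⟨0, ?_⟩⟩))
      · have h1 : S ∈ logDer g := (hspan.le hS : S ∈ diagonalLog g).1
        exact (Submodule.add_mem_iff_right _ h1).1 hD
      · obtain ⟨e, rfl⟩ : ∃ e, S = diagonalField e :=
          ⟨_, (hspan.le hS : S ∈ diagonalLog g).2.1.eq_diagonalField⟩
        have h2 : ⁅diagonalField (d i), diagonalField e + N⁆ =
            ⁅diagonalField (d i), diagonalField e⁆ + ⁅diagonalField (d i), N⁆ := by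
          ext1 h
          simp only [Derivation.commutator_apply, Derivation.add_apply, map_add]
          ring
        rw [hcomm i, lie_diagonalField_diagonalField, zero_add] at h2
        rw [← h2]
        simp
    · obtain ⟨i, hi⟩ := Function.ne_iff.1 hw
      refine Submodule.subset_span (Or.inr ⟨hD, ⟨hvan hD, ?_⟩, fun i => ?_⟩)
      · exact isNilpotent_linearMatrix_of_isHomogDer hi
          (lie_diagonalField_eq_smul_iff.1 (hlie i))
      · obtain ⟨q, hq⟩ := isHomogDer_rational hd hwD hD0 i
        exact ⟨q, hq ▸ hlie i⟩
  intro D hD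
  -- A field is only a limit of finite sums of its components, so closedness of the span is needed.
  refine mem_of_forall_mem_sup fun k => ?_
  obtain ⟨F, hF⟩ := exists_sub_sum_derivComp_mem (jointWt d) k D
  exact Submodule.mem_sup.2 ⟨_, sum_mem fun w _ => hhom w _ (derivComp_mem_logDer w hw₀ hD)
    (isHomogDer_derivComp w D), _, hF, add_sub_cancel _ _⟩

/-- Elements of `𝔪 N` have zero linear part when `N ≤ 𝔪 · Der`, whereas a diagonal field equals its
linear part. For `N = Der_g` this uses that `g` is not a product. -/
theorem linearIndependent_mkQ_diagonalField {N : Submodule (PS n) (VF n)} (hN : N ≤ vanishing n)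
    {s : ℕ} {d : Fin s → Fin n → ℂ} (hlin : LinearIndependent ℂ fun i => diagonalField (d i)) :
    LinearIndependent ℂ fun i =>
      ((maximalIdeal (PS n) • N).restrictScalars ℂ).mkQ (diagonalField (d i)) := by
  rw [Fintype.linearIndependent_iff] at hlin ⊢
  intro c hc
  refine hlin c ?_
  simp_rw [← map_smul, ← map_sum] at hc
  rw [Submodule.mkQ_apply, Submodule.Quotient.mk_eq_zero] at hc
  have h1 := linearMatrix_eq_zero_of_mem_smul hN hc
  have h2 : ∑ i, c i • diagonalField (d i) = diagonalField (∑ i, c i • d i) := by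
    let L : (Fin n → ℂ) →ₗ[ℂ] VF n :=
      { toFun := diagonalField, map_add' := diagonalField_add, map_smul' := diagonalField_smul }
    change ∑ i, c i • L (d i) = L (∑ i, c i • d i)
    simp
  rw [h2, linearMatrix_diagonalField] at h1
  rw [h2, diagonalField, h1]
  simp [linearField]

end FormalVectorField

end

open FormalVectorField

/-! ### The formal structure theorem -/

theorem theorem6 (n : ℕ) (f : PS n) (hf : f ≠ 0) (hprod : ¬ IsProduct f) :
    ∃ s : ℕ, IsGreatest (diagonalDims f) s ∧
      ∃ (φ : PS n ≃ₐ[ℂ] PS n) (u : (PS n)ˣ) (g : PS n), g = (u : PS n) * φ f ∧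
      ∃ (r : ℕ) (σ : Fin s → VF n) (ν : Fin r → VF n) (m : ℕ) (p : Fin m → PS n),
        AreIrreducibleFactors p g ∧
        IsMinimalGenerators (Sum.elim σ ν) (logDer g) ∧
        (∀ δ ∈ logDer g, (∀ i, ⁅σ i, δ⁆ = 0) →
          ∃ S : VF n, IsSemisimplePart S δ ∧ S ∈ Submodule.span ℂ (Set.range σ)) ∧
        (∀ i, IsDiagonalField (σ i) ∧ ∀ k, ∃ q : ℚ, linearMatrix (σ i) k k = (q : ℂ)) ∧
        (∀ j, IsNilpotentField (ν j)) ∧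
        (∀ i j, ∃ q : ℚ, ⁅σ i, ν j⁆ = (q : ℂ) • ν j) ∧
        (∀ i j, ∃ q : ℚ, (σ i) (p j) = (q : ℂ) • p j) := by
  obtain ⟨s, hs⟩ := exists_isGreatest_diagonalDims f
  obtain ⟨g, hfg, rfl⟩ := hs.1
  have hvan : logDer g ≤ vanishing n :=
    logDer_le_vanishing_of_contactEquiv hfg (not_not.1 hprod)
  obtain ⟨φ, u, hg⟩ := id hfg
  have hg0 : g ≠ 0 := by
    rw [hg]
    exact mul_ne_zero u.ne_zero ((map_ne_zero_iff φ φ.injective).2 hf)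
  have hmax : ∀ g', ContactEquiv g g' →
      Module.finrank ℂ (diagonalLog g') ≤ Module.finrank ℂ (diagonalLog g) :=
    fun g' hg' => hs.2 ⟨g', hfg.trans hg', rfl⟩
  obtain ⟨d, hd, hlin, hspan⟩ := exists_rational_basis_diagonalLog hg0
  have hσ : ∀ i, diagonalField (d i) ∈ diagonalLog g := fun i =>
    hspan.le (Submodule.subset_span ⟨i, rfl⟩)
  obtain ⟨r, ν, hν, hmin⟩ := exists_minimalGenerators (N := logDer g) (fun i => (hσ i).1)
    (fun x hx => hx.1) (logDer_le_span hg0 hvan hd hspan hmax)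
    (linearIndependent_mkQ_diagonalField hvan hlin)
  obtain ⟨m, p, l, hirr, hassoc, hl, hprodg⟩ := exists_irreducible_factorization hg0
  have hhom : ∀ j, ∃ q w, Associated (p j) q ∧ IsHomog (jointWt d) w q := fun j =>
    exists_associated_isHomog (hirr j).ne_zero fun i => mem_logDer_iff.2 <|
      prime_dvd_derivation hg0 (hirr j).prime
        (((dvd_pow_self _ (hl j).ne').trans
          (Finset.dvd_prod_of_mem (fun j => p j ^ l j) (Finset.mem_univ j))).trans hprodg.dvd)
        (hσ i).1
  choose q w hpq hw using hhom
  have hgq : Associated g (∏ j, q j ^ l j) :=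
    hprodg.symm.trans (Associated.prod _ _ _ fun j _ => (hpq j).pow_pow)
  obtain ⟨v, hv⟩ := hgq
  -- The final series is the product of the homogeneous factors, which differs from the maximizing
  -- `g` by the unit `v`; its logarithmic fields are the same.
  refine ⟨_, hs, φ, v * u, ∏ j, q j ^ l j, ?_, r, fun i => diagonalField (d i), ν, m, q, ?_⟩
  · rw [← hv, hg, Units.val_mul]
    ring
  rw [← logDer_eq_of_associated ⟨v, hv⟩]
  refine ⟨⟨fun j => (hpq j).irreducible (hirr j), fun j k hjk h =>
    hassoc j k hjk (((hpq j).trans h).trans (hpq k).symm), l, hl, rfl⟩, hmin, ?_, ?_,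
    fun j => (hν j).2.1, fun i j => (hν j).2.2 i, fun i j => ?_⟩
  · intro δ hδ hcomm
    obtain ⟨S, hS, hSδ⟩ := exists_isSemisimplePart_mem_diagonalLog hg0 hmax hδ (hvan hδ)
      fun σ hσ => lie_eq_zero_of_mem_span (by rintro _ ⟨i, rfl⟩; exact hcomm i) (hspan.ge hσ)
    exact ⟨S, hSδ, hspan.ge hS⟩
  · intro i
    refine ⟨isDiagonalField_diagonalField _, fun k => ?_⟩
    rw [linearMatrix_diagonalField, Matrix.diagonal_apply_eq]
    exact hd i k
  · obtain ⟨c, hc⟩ := isHomog_rational hd (hw j) ((hpq j).ne_zero_iff.1 (hirr j).ne_zero) i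
    exact ⟨c, hc ▸ isHomog_jointWt_iff.1 (hw j) i⟩
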